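/- **Problem.** Let $G=(V,E)$ be a finite undirected graph with real edge costs $c_e\ge 0$. A function $f:2^V\to\{0,1\}$ is *proper* if $f(S)=f(V\setminus S)$ for all $S$, $f(\emptyset)=f(V)=0$, and $f(A\cup B)\le\max(f(A),f(B))$ for disjoint $A,B$. Proper functions $f_1,f_2,\dots$ arrive one per time step; put $g_i=\max(f_1,\dots,f_i)$ and $R_i=\{v: g_i(\{v\})=1\}$ (the terminals). A set $F\subseteq E$ is feasible for $(IP_i)$ if $\delta(S)\cap F\ne\emptyset$ whenever $g_i(S)=1$, where $\delta(S)$ is the set of edges with exactly one endpoint in $S$; $OPT_i$ is the minimum cost of a feasible set. Assume that $E$ itself is feasible for every $f_i$. **Algorithm.** It keeps a set $F$ (initially $\emptyset$) and, for every level $j\in\mathbb Z$, a dual vector $y^j$ (initially $0$), an edge set $\bar F^j$ and a vertex set $P_j$ (initially empty). A *moat* of level $j$ is a connected component of $(V,\bar F^j)$; an edge $e$ is *tight* in level $j$ if $\sum_{S:e\in\delta(S)}y^j_S=c_e$; $y^j_S$ *has reached its limit* if $\sum_{T\ni s}y^j_T=2^j$ for some terminal $s\in S$; a moat $S$ is *active*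 if $g_i(S)=1$ and $y_S^j$ has not reached its limit. At the start of time step $i$, let $A$ be the set of terminals whose component $X$ of $(V,F)$ has $g_i(X)=1$. Process the levels $j$ from $-\infty$ to $\infty$ (at all sufficiently low levels nothing is built, except that some edges of cost $0$ may be built at the start of the time step, before $A$ is determined). At level $j$ put $A_j=A$ and do the following. * *Consolidate.* While there is an edge of $F\setminus\bar F^j$, add one to $\bar F^j$; then, while some $s_1\in A_j$ and $s_2\in P_j$ lie in the same moat but are not connected in $F$, *connect* such an $s_1$ to $P_j$. * *Dual growth.* While $A_j\ne\emptyset$, raise all $y^j_S$ with $S$ an active moat uniformly until (1) one of them reaches its limit, or (2) an edge outside $\bar F^j$ is tight; then add it to $\bar F^j$, or (3) some $s_1\in A_j$ and $s_2\in A_j\cup P_j$ lie in the same moat but are not connected in $F$; then *connect* such an $s_1$ to $A_j\cup P_j$. A terminal of $A_j$ that reaches its limit ($\sum_{T\ni s}y^j_T=2^j$) moves to $P_j$. The loop also stops when there is no active moat and neither (2) nor (3) applies. * At the end of the level the remaining elements of $A_j$ are added to $P_j$. To *connect* $s_1$ to $Q$ means: among all paths, consisting of edges of $\bar F^j\cup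 F$, from $s_1$ to those $s_2\in Q$ in its moat that are not connected to $s_1$ in $F$, choose one, $p$, minimizing $\sum_{e\in p\setminus F}c_e$; set $F\gets F\cup p$; remove from $A$ and $A_j$ the terminals whose component $X$ of $(V,F)$ now has $g_i(X)=0$, and move those of $A_j$ to $P_j$. All choices that are left open are arbitrary. The output of time step $i$ is $F$. **Theorem.** The algorithm is $O(\log|R_i|)$-competitive. Precisely: whatever choices were made so far, every time step $i$ can be carried out so that no terminal is active at any sufficiently high level; and for every way of carrying it out, no edge is removed from $F$, the resulting $F$ is feasible for $(IP_i)$, and $$\sum_{e\in F}c_e\le 2(\log_2|R_i|+3)\,OPT_i\qquad\text{and}\qquad \sum_{e\in F}c_e\le 8\log_2|R_i|\;OPT_i ,$$ where $\log_2 0$ is read as $0$ (if $R_i=\emptyset$, both sides are $0$). -/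

import Mathlib

namespace OnlineForest

noncomputable section

open scoped Classical
open Filter

universe u

variable {V : Type u} [Fintype V]

/-! ### The problem -/

/-- A `{0,1}`-valued set function (`true` is `1`) is proper. -/
structure IsProper (f : Finset V → Bool) : Prop where
  compl : ∀ S : Finset V, f Sᶜ = f S
  empty : f ∅ = false
  univ : f Finset.univ = false
  union : ∀ A B : Finset V, Disjoint A B → f (A ∪ B) ≤ max (f A) (f B)

/-- The edge set `E` of the graph. -/
def edges (G : SimpleGraph V) : Finset (Sym2 V) :=
  Finset.univ.filter (fun e => e ∈ G.edgeSet)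

/-- `δ(S)`: the edges with exactly one endpoint in `S`. -/
def delta (G : SimpleGraph V) (S : Finset V) : Finset (Sym2 V) :=
  (edges G).filter (fun e => ∃ u ∈ S, ∃ v ∉ S, e = s(u, v))

/-- Total cost of a set of edges. -/
def cost (c : Sym2 V → ℝ) (F : Finset (Sym2 V)) : ℝ := ∑ e ∈ F, c e

/-- `F` is a feasible solution of the integer program with requirement function `g`. -/
def Feasible (G : SimpleGraph V) (g : Finset V → Bool) (F : Finset (Sym2 V)) : Prop :=
  F ⊆ edges G ∧ ∀ S : Finset V, g S = true → 1 ≤ (delta G S ∩ F).card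

/-- Optimal value of the integer program with requirement function `g` (the infimum over a finite
set, hence a minimum as soon as there is a feasible solution). -/
def opt (G : SimpleGraph V) (c : Sym2 V → ℝ) (g : Finset V → Bool) : ℝ :=
  sInf {x : ℝ | ∃ F : Finset (Sym2 V), Feasible G g F ∧ x = cost c F}

/-- `g_i(S) = max (f_0(S), …, f_i(S))`; the time steps are numbered from `0`. -/
def cumul (f : ℕ → Finset V → Bool) (i : ℕ) (S : Finset V) : Bool :=
  (Finset.range (i + 1)).sup (fun k => f k S)

/-- The terminals of `g`: the vertices `v` with `g({v}) = 1`. -/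
def terminals (g : Finset V → Bool) : Finset V :=
  Finset.univ.filter (fun v => g {v} = true)

/-! ### Connectivity in a set of edges -/

/-- `u` and `v` are connected in `(V, F)`. -/
def Conn (F : Finset (Sym2 V)) (u v : V) : Prop :=
  (SimpleGraph.fromEdgeSet (F : Set (Sym2 V))).Reachable u v

/-- The connected component of `v` in `(V, F)`. -/
def comp (F : Finset (Sym2 V)) (v : V) : Finset V :=
  Finset.univ.filter (fun w => Conn F v w)

/-- `p` is the edge set of a simple path from `u` to `v` in `(V, H)`. -/
def IsPathSet (H : Finset (Sym2 V)) (u v : V) (p : Finset (Sym2 V)) : Prop :=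
  ∃ w : (SimpleGraph.fromEdgeSet (H : Set (Sym2 V))).Walk u v,
    w.IsPath ∧ p = w.edges.toFinset

/-- `S` is violated for `g` by the edges `F`. -/
def Violated (G : SimpleGraph V) (g : Finset V → Bool) (F : Finset (Sym2 V))
    (S : Finset V) : Prop :=
  g S = true ∧ delta G S ∩ F = ∅

/-- The terminals whose component in `F` is violated. -/
def activeTerminals (G : SimpleGraph V) (g : Finset V → Bool) (F : Finset (Sym2 V)) : Finset V :=
  (terminals g).filter (fun s => Violated G g F (comp F s))

/-! ### The data of one level -/

/-- What the algorithm stores for one level `j`: the dual vector `y^j`, the edge set `F̄^j`, and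
the set `P_j` of terminals that have previously been active at this level. -/
structure LevelData (V : Type u) where
  y : Finset V → ℝ
  Fbar : Finset (Sym2 V)
  prev : Finset V

/-- `∑_{S ∋ v} y_S`. -/
def LevelData.load (d : LevelData V) (v : V) : ℝ :=
  ∑ S ∈ Finset.univ.filter (fun S : Finset V => v ∈ S), d.y S

/-- The edge `e` is tight: `∑_{S : e ∈ δ(S)} y_S = c_e`. -/
def LevelData.IsTight (G : SimpleGraph V) (c : Sym2 V → ℝ) (d : LevelData V)
    (e : Sym2 V) : Prop :=
  ∑ S ∈ Finset.univ.filter (fun S : Finset V => e ∈ delta G S), d.y S = c e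

/-- `y_S^j` has reached its limit: some terminal `s ∈ S` has `∑_{T ∋ s} y_T^j = 2^j`. -/
def LevelData.AtLimit (g : Finset V → Bool) (j : ℤ) (d : LevelData V) (S : Finset V) : Prop :=
  ∃ s ∈ S, s ∈ terminals g ∧ d.load s = (2 : ℝ) ^ j

/-- `S` is an active moat of level `j`: a connected component of `F̄^j` with `g(S) = 1` whose dual
variable has not reached its limit. -/
def LevelData.IsActiveMoat (g : Finset V → Bool) (j : ℤ) (d : LevelData V)
    (S : Finset V) : Prop :=
  (∃ v : V, S = comp d.Fbar v) ∧ g S = true ∧ ¬ d.AtLimit g j S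

/-! ### The work at one level

A configuration during the work at level `j`: the current solution `F`, the set `A` of active
terminals, the set `Aj` of terminals active at level `j`, and the data of level `j`. -/

structure Config (V : Type u) where
  F : Finset (Sym2 V)
  A : Finset V
  Aj : Finset V
  lev : LevelData V

/-- Add the edge `e` to `F̄^j`. -/
def Config.addEdge (x : Config V) (e : Sym2 V) : Config V :=
  { x with lev := { x.lev with Fbar := insert e x.lev.Fbar } }

/-- Build the edges of `p` in `F` and update `A`: the terminals whose component is no longer
violated become inactive, and those of them in `A_j` move to `P_j`. -/
def Config.build (G : SimpleGraph V) (g : Finset V → Bool) (x : Config V)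
    (p : Finset (Sym2 V)) : Config V where
  F := x.F ∪ p
  A := x.A ∩ activeTerminals G g (x.F ∪ p)
  Aj := x.Aj ∩ activeTerminals G g (x.F ∪ p)
  lev := { x.lev with prev := x.lev.prev ∪ (x.Aj \ activeTerminals G g (x.F ∪ p)) }

/-- `s₁ ∈ A_j` and `s₂ ∈ Q` lie in the same moat but are not connected in `F`. -/
def Config.CanConnect (x : Config V) (Q : Finset V) (s₁ s₂ : V) : Prop :=
  s₁ ∈ x.Aj ∧ s₂ ∈ Q ∧ Conn x.lev.Fbar s₁ s₂ ∧ ¬ Conn x.F s₁ s₂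

/-- One purchase: some `s₁ ∈ A_j` that shares its moat with a terminal of `Q` not connected to it
in `F` is joined to such a terminal `s₂` by a path `p` of edges in `F̄^j` or `F`, where
`∑_{e ∈ p - F} c_e` is as small as possible for `s₁`. -/
def Connect (G : SimpleGraph V) (c : Sym2 V → ℝ) (g : Finset V → Bool) (Q : Finset V)
    (x x' : Config V) : Prop :=
  ∃ (s₁ s₂ : V) (p : Finset (Sym2 V)),
    x.CanConnect Q s₁ s₂ ∧ IsPathSet (x.lev.Fbar ∪ x.F) s₁ s₂ p ∧
    (∀ (t : V) (q : Finset (Sym2 V)), x.CanConnect Q s₁ t →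
      IsPathSet (x.lev.Fbar ∪ x.F) s₁ t q → cost c (p \ x.F) ≤ cost c (q \ x.F)) ∧
    x' = x.build G g p

/-- The inner loop of the consolidate loop: while there are `s₁ ∈ A_j`, `s₂ ∈ P_j` in the same
moat that are not connected in `F`, build a path. -/
inductive ConnectLoop (G : SimpleGraph V) (c : Sym2 V → ℝ) (g : Finset V → Bool) :
    Config V → Config V → Prop
  | done (x : Config V) (h : ∀ s₁ s₂, ¬ x.CanConnect x.lev.prev s₁ s₂) : ConnectLoop G c g x x
  | step (x x' x'' : Config V) (h : Connect G c g x.lev.prev x x')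
      (h' : ConnectLoop G c g x' x'') : ConnectLoop G c g x x''

/-- The consolidate loop: while there is an edge of `F` outside `F̄^j`, add it to `F̄^j` and run
the inner loop. -/
inductive ConsolidateLoop (G : SimpleGraph V) (c : Sym2 V → ℝ) (g : Finset V → Bool) :
    Config V → Config V → Prop
  | done (x : Config V) (h : x.F ⊆ x.lev.Fbar) : ConsolidateLoop G c g x x
  | step (x x' x'' : Config V) (e : Sym2 V) (he : e ∈ x.F \ x.lev.Fbar)
      (h : ConnectLoop G c g (x.addEdge e) x') (h' : ConsolidateLoop G c g x' x'') :
      ConsolidateLoop G c g x x''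

/-- The dual vector after raising all active dual variables of the level by `ε`. -/
def LevelData.raise (g : Finset V → Bool) (j : ℤ) (d : LevelData V) (ε : ℝ) : LevelData V :=
  { d with y := fun S => if d.IsActiveMoat g j S then d.y S + ε else d.y S }

/-- The terminals of `A_j` that reach their limit when all active dual variables grow by `ε`. -/
def Config.limited (g : Finset V → Bool) (j : ℤ) (x : Config V) (ε : ℝ) : Finset V :=
  x.Aj.filter (fun s => x.lev.IsActiveMoat g j (comp x.lev.Fbar s) ∧
    (x.lev.raise g j ε).load s = (2 : ℝ) ^ j)

/-- Grow all active dual variables of level `j` by `ε`; a terminal of `A_j` that reaches its limit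
thereby moves to `P_j`. -/
def Config.grow (g : Finset V → Bool) (j : ℤ) (x : Config V) (ε : ℝ) : Config V :=
  { x with
    Aj := x.Aj \ x.limited g j ε
    lev := { x.lev.raise g j ε with prev := x.lev.prev ∪ x.limited g j ε } }

/-- Event (1): after growth by `ε`, a dual variable that was active has reached its limit. -/
def LimitEvent (g : Finset V → Bool) (j : ℤ) (x : Config V) (ε : ℝ) : Prop :=
  ∃ S : Finset V, x.lev.IsActiveMoat g j S ∧ (x.grow g j ε).lev.AtLimit g j S

/-- Event (2): the edge `e`, not yet in `F̄^j`, is tight. -/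
def TightEvent (G : SimpleGraph V) (c : Sym2 V → ℝ) (x : Config V) (e : Sym2 V) : Prop :=
  e ∈ edges G ∧ e ∉ x.lev.Fbar ∧ x.lev.IsTight G c e

/-- Event (3): some `s₁ ∈ A_j` and `s₂ ∈ A_j ∪ P_j` connect in level `j`. -/
def ConnectEvent (x : Config V) : Prop :=
  ∃ s₁ s₂, x.CanConnect (x.Aj ∪ x.lev.prev) s₁ s₂

/-- One of the three events has occurred after growth by `ε`. -/
def Event (G : SimpleGraph V) (c : Sym2 V → ℝ) (g : Finset V → Bool) (j : ℤ) (x : Config V)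
    (ε : ℝ) : Prop :=
  LimitEvent g j x ε ∨ (∃ e, TightEvent G c (x.grow g j ε) e) ∨ ConnectEvent (x.grow g j ε)

/-- One iteration of the dual growth loop: grow all active dual variables uniformly until one of
the three events occurs (the growth is `0` if one has already occurred), and handle an event that
has occurred. -/
def GrowthIter (G : SimpleGraph V) (c : Sym2 V → ℝ) (g : Finset V → Bool) (j : ℤ)
    (x x' : Config V) : Prop :=
  ∃ ε : ℝ, 0 ≤ ε ∧ (∀ ε' : ℝ, 0 ≤ ε' → ε' < ε → ¬ Event G c g j x ε') ∧
    ((LimitEvent g j x ε ∧ x' = x.grow g j ε) ∨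
     (∃ e, TightEvent G c (x.grow g j ε) e ∧ x' = (x.grow g j ε).addEdge e) ∨
     Connect G c g ((x.grow g j ε).Aj ∪ (x.grow g j ε).lev.prev) (x.grow g j ε) x')

/-- The dual growth loop runs until no terminal is active at level `j`, or no event has occurred
and no dual variable can be increased any more because all have reached their limits. -/
inductive GrowthLoop (G : SimpleGraph V) (c : Sym2 V → ℝ) (g : Finset V → Bool) (j : ℤ) :
    Config V → Config V → Prop
  | done (x : Config V)
      (h : x.Aj = ∅ ∨ ((∀ S, ¬ x.lev.IsActiveMoat g j S) ∧ ¬ Event G c g j x 0)) :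
      GrowthLoop G c g j x x
  | step (x x' x'' : Config V) (hA : x.Aj.Nonempty) (h : GrowthIter G c g j x x')
      (h' : GrowthLoop G c g j x' x'') : GrowthLoop G c g j x x''

/-- The work at level `j`: it starts from the solution `F`, the active terminals `A` (all of them
are active at level `j`) and the data `d` of the level, and ends with `F'`, `A'`, `d'`. -/
def LevelRun (G : SimpleGraph V) (c : Sym2 V → ℝ) (g : Finset V → Bool) (j : ℤ)
    (F : Finset (Sym2 V)) (A : Finset V) (d : LevelData V)
    (F' : Finset (Sym2 V)) (A' : Finset V) (d' : LevelData V) : Prop :=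
  ∃ x x' : Config V,
    ConsolidateLoop G c g { F := F, A := A, Aj := A, lev := d } x ∧
    GrowthLoop G c g j x x' ∧
    F' = x'.F ∧ A' = x'.A ∧ d' = { x'.lev with prev := x'.lev.prev ∪ x'.Aj }

/-! ### The online algorithm -/

/-- What the algorithm keeps between two time steps. -/
structure State (V : Type u) where
  F : Finset (Sym2 V)
  lev : ℤ → LevelData V

/-- Before the first time step everything is empty or zero. -/
def State.init : State V where
  F := ∅
  lev := fun _ => { y := fun _ => 0, Fbar := ∅, prev := ∅ }

/-- One time step, for the current requirement function `g = g_i`: the levels `j` are processed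
from `-∞` to `∞`. `Fs j` and `As j` are the solution and the set of active terminals when the work
at level `j` begins. As there is no first level, the start of the loop is expressed at all
sufficiently low levels. An edge of cost `0` is tight at every level, so some edges `Z` of cost `0`
may already have been built there (if all costs are positive, then `Z = ∅`). At all sufficiently
high levels no terminal is active any more and the solution is the output `σ'.F`. -/
def TimeStep (G : SimpleGraph V) (c : Sym2 V → ℝ) (g : Finset V → Bool)
    (σ σ' : State V) : Prop :=
  ∃ (Fs : ℤ → Finset (Sym2 V)) (As : ℤ → Finset V) (Z : Finset (Sym2 V)),
    Z ⊆ edges G ∧ (∀ e ∈ Z, c e = 0) ∧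
    (∀ᶠ j in atBot, Fs j = σ.F ∪ Z ∧ As j = activeTerminals G g (σ.F ∪ Z)) ∧
    (∀ j : ℤ, LevelRun G c g j (Fs j) (As j) (σ.lev j) (Fs (j + 1)) (As (j + 1)) (σ'.lev j)) ∧
    (∀ᶠ j in atTop, Fs j = σ'.F ∧ As j = ∅)

/-- `σ` is a possible state of the algorithm just before time step `i`, on the input `f`. -/
inductive Reachable (G : SimpleGraph V) (c : Sym2 V → ℝ) (f : ℕ → Finset V → Bool) :
    ℕ → State V → Prop
  | init : Reachable G c f 0 State.init
  | step (i : ℕ) (σ σ' : State V) (h : Reachable G c f i σ)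
      (h' : TimeStep G c (cumul f i) σ σ') : Reachable G c f (i + 1) σ'

end

end OnlineForest

namespace OnlineForest

noncomputable section

open scoped Classical
open Filter

universe u

variable {V : Type u} [Fintype V]

set_option linter.unusedSectionVars false

/-! ### Connectivity -/

/-! The proof charges every purchase to dual solutions of all lower levels. At level `j` the dual
vector is a feasible packing in which no vertex has load above `2 ^ j`. Choose a set `W j` of
terminals of full load, no two of them in one set of the support, such that every fully loaded
vertex shares its moat with one of them. Weak duality gives `2 ^ j * |W j| ≤ OPT`
(`LevelInv.mul_card_le_cost`). The sets `W j` only grow over time.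

Two facts tie the duals to `F`. First, a purchase at level `j` costs at most `2 * 2 ^ j`: every
vertex of a moat meeting `Q` is near an element of `Q`, and somewhere along a path through the moat
the nearby element changes its component of `F` (`LevelInv.exists_near`). Second, a terminal still
active at the end of level `k` is connected in `F` to `W k` (`GrowInv.conn_of_done`). Hence a
purchase at level `j` merges two components of `F` that both meet every `W k` with `k < j`, and both
meet the terminal set `R`.

Let `rank F U` count the merges seen by `U`. Each such purchase raises the rank of `R` and of every
`W k`, `k < j`, by at least one, and its price is at most `2 * (2 ^ (K + 1) + ∑_{K < k < j} 2 ^ k)`.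
So `cost F ≤ 2 * (2 ^ (K + 1) * rank F R + ∑_{K < k ≤ T} 2 ^ k * rank F (W k))` whenever `W` is
empty above `T`. Each summand is at most `OPT`. Taking `2 ^ K` near `OPT / |R|` and `2 ^ T` near
`OPT` leaves at most `log₂ |R| + 1` summands, and the first term is at most `2 * OPT`.

A time step can be carried out because each loop has a decreasing integer measure. At very low
levels a newly built edge would be tight, hence of cost at most `2 * 2 ^ j`, hence of cost `0`. At
very high levels a surviving terminal would make `W j` nonempty and force `2 ^ j ≤ cost E`. -/

theorem Conn.refl (F : Finset (Sym2 V)) (u : V) : Conn F u u := SimpleGraph.Reachable.refl u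

theorem Conn.symm {F : Finset (Sym2 V)} {u v : V} (h : Conn F u v) : Conn F v u :=
  SimpleGraph.Reachable.symm h

theorem Conn.trans {F : Finset (Sym2 V)} {u v w : V} (h : Conn F u v) (h' : Conn F v w) :
    Conn F u w :=
  SimpleGraph.Reachable.trans h h'

theorem Conn.mono {F F' : Finset (Sym2 V)} (hF : F ⊆ F') {u v : V} (h : Conn F u v) :
    Conn F' u v :=
  SimpleGraph.Reachable.mono (SimpleGraph.fromEdgeSet_mono (by exact_mod_cast hF)) h

theorem Conn.of_mem {F : Finset (Sym2 V)} {u v : V} (h : s(u, v) ∈ F) : Conn F u v := by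
  by_cases huv : u = v
  · subst huv
    exact Conn.refl F u
  · exact SimpleGraph.Adj.reachable ((SimpleGraph.fromEdgeSet_adj _).2 ⟨by exact_mod_cast h, huv⟩)

theorem Conn.induction {F : Finset (Sym2 V)} {u v : V} (h : Conn F u v) {motive : V → Prop}
    (base : motive u)
    (step : ∀ a b, Conn F u a → s(a, b) ∈ F → motive a → motive b) : motive v := by
  have h' := (SimpleGraph.reachable_iff_reflTransGen u v).1 h
  have : Conn F u v ∧ motive v := by
    induction h' with
    | refl => exact ⟨Conn.refl F u, base⟩
    | tail hab hbc ih =>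
      have ih := ih ((SimpleGraph.reachable_iff_reflTransGen _ _).2 hab)
      have hm := ((SimpleGraph.fromEdgeSet_adj _).1 hbc).1
      have hm' := Finset.mem_coe.1 hm
      exact ⟨ih.1.trans (Conn.of_mem hm'), step _ _ ih.1 hm' ih.2⟩
  exact this.2

theorem Conn.of_insert {F : Finset (Sym2 V)} {a b u v : V} (h : Conn (insert s(a, b) F) u v) :
    Conn F u v ∨ (Conn F u a ∧ Conn F b v) ∨ (Conn F u b ∧ Conn F a v) := by
  refine h.induction (motive := fun v => Conn F u v ∨ (Conn F u a ∧ Conn F b v) ∨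
    (Conn F u b ∧ Conn F a v)) (Or.inl (Conn.refl F u)) ?_
  intro x y _ hxy ih
  rcases Finset.mem_insert.1 hxy with h | h
  · rcases Sym2.eq_iff.1 h with ⟨rfl, rfl⟩ | ⟨rfl, rfl⟩
    · rcases ih with h | ⟨h, _⟩ | ⟨h, _⟩
      · exact Or.inr (Or.inl ⟨h, Conn.refl F _⟩)
      · exact Or.inr (Or.inl ⟨h, Conn.refl F _⟩)
      · exact Or.inl h
    · rcases ih with h | ⟨h, _⟩ | ⟨h, _⟩
      · exact Or.inr (Or.inr ⟨h, Conn.refl F _⟩)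
      · exact Or.inl h
      · exact Or.inr (Or.inr ⟨h, Conn.refl F _⟩)
  · have h := Conn.of_mem h
    rcases ih with h1 | ⟨h1, h2⟩ | ⟨h1, h2⟩
    · exact Or.inl (h1.trans h)
    · exact Or.inr (Or.inl ⟨h1, h2.trans h⟩)
    · exact Or.inr (Or.inr ⟨h1, h2.trans h⟩)

theorem mem_comp {F : Finset (Sym2 V)} {u v : V} : v ∈ comp F u ↔ Conn F u v := by
  simp [comp]

theorem comp_eq_iff {F : Finset (Sym2 V)} {u v : V} : comp F u = comp F v ↔ Conn F u v := by
  constructor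
  · intro h
    rw [← mem_comp, h, mem_comp]
    exact Conn.refl F v
  · intro h
    ext w
    rw [mem_comp, mem_comp]
    exact ⟨fun h' => h.symm.trans h', fun h' => h.trans h'⟩

theorem conn_empty {u v : V} : Conn (∅ : Finset (Sym2 V)) u v ↔ u = v := by
  constructor
  · intro h
    exact h.induction (motive := fun v => u = v) rfl (by simp)
  · rintro rfl
    exact Conn.refl _ u

theorem comp_empty (v : V) : comp (∅ : Finset (Sym2 V)) v = {v} := by
  ext w
  rw [mem_comp, conn_empty, Finset.mem_singleton, eq_comm]

theorem mem_delta {G : SimpleGraph V} {S : Finset V} {a b : V} :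
    s(a, b) ∈ delta G S ↔ s(a, b) ∈ edges G ∧ ((a ∈ S ∧ b ∉ S) ∨ (b ∈ S ∧ a ∉ S)) := by
  unfold delta
  rw [Finset.mem_filter]
  refine and_congr_right fun _ => ⟨?_, ?_⟩
  · rintro ⟨u, hu, v, hv, h⟩
    rcases Sym2.eq_iff.1 h with ⟨rfl, rfl⟩ | ⟨rfl, rfl⟩
    · exact Or.inl ⟨hu, hv⟩
    · exact Or.inr ⟨hu, hv⟩
  · rintro (⟨h1, h2⟩ | ⟨h1, h2⟩)
    · exact ⟨a, h1, b, h2, rfl⟩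
    · exact ⟨b, h1, a, h2, Sym2.eq_swap⟩

theorem delta_comp_inter (G : SimpleGraph V) (F : Finset (Sym2 V)) (v : V) :
    delta G (comp F v) ∩ F = ∅ := by
  rw [Finset.eq_empty_iff_forall_notMem]
  intro e he
  induction e using Sym2.ind with
  | _ a b =>
    rw [Finset.mem_inter, mem_delta, mem_comp, mem_comp] at he
    obtain ⟨⟨_, h⟩, hF⟩ := he
    have hab := Conn.of_mem hF
    rcases h with ⟨h1, h2⟩ | ⟨h1, h2⟩
    · exact h2 (h1.trans hab)
    · exact h2 (h1.trans hab.symm)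

theorem mem_activeTerminals {G : SimpleGraph V} {g : Finset V → Bool} {F : Finset (Sym2 V)}
    {s : V} : s ∈ activeTerminals G g F ↔ s ∈ terminals g ∧ g (comp F s) = true := by
  simp [activeTerminals, Violated, delta_comp_inter]

theorem mem_terminals {g : Finset V → Bool} {s : V} : s ∈ terminals g ↔ g {s} = true := by
  simp [terminals]

theorem IsPathSet.subset {H p : Finset (Sym2 V)} {u v : V} (h : IsPathSet H u v p) : p ⊆ H := by
  obtain ⟨w, _, rfl⟩ := h
  intro e he
  have := w.edges_subset_edgeSet (List.mem_toFinset.1 he)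
  rw [SimpleGraph.edgeSet_fromEdgeSet] at this
  exact_mod_cast this.1

theorem IsPathSet.conn {H p : Finset (Sym2 V)} {u v : V} (h : IsPathSet H u v p) :
    Conn p u v := by
  obtain ⟨w, _, rfl⟩ := h
  refine ⟨w.transfer _ fun e he => ?_⟩
  rw [SimpleGraph.edgeSet_fromEdgeSet]
  refine ⟨by simpa using he, ?_⟩
  have := w.edges_subset_edgeSet he
  rw [SimpleGraph.edgeSet_fromEdgeSet] at this
  exact this.2

theorem exists_isPathSet {H q : Finset (Sym2 V)} {u v : V} (hq : q ⊆ H) (h : Conn q u v) :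
    ∃ p, p ⊆ q ∧ IsPathSet H u v p := by
  obtain ⟨w⟩ := h
  obtain ⟨w, hw⟩ : ∃ w : (SimpleGraph.fromEdgeSet (q : Set (Sym2 V))).Walk u v, w.IsPath :=
    ⟨w.bypass, w.bypass_isPath⟩
  have hle : SimpleGraph.fromEdgeSet (q : Set (Sym2 V)) ≤
      SimpleGraph.fromEdgeSet (H : Set (Sym2 V)) :=
    SimpleGraph.fromEdgeSet_mono (by exact_mod_cast hq)
  refine ⟨w.edges.toFinset, IsPathSet.subset ⟨w, hw, rfl⟩, w.mapLe hle,
    (SimpleGraph.Walk.isPath_mapLe hle).2 hw, ?_⟩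
  simp

/-! ### Cost -/

theorem cost_mono {c : Sym2 V → ℝ} {F F' : Finset (Sym2 V)} (h : F ⊆ F')
    (hc : ∀ e ∈ F', 0 ≤ c e) : cost c F ≤ cost c F' :=
  Finset.sum_le_sum_of_subset_of_nonneg h fun e he _ => hc e he

theorem cost_union_le {c : Sym2 V → ℝ} {F F' : Finset (Sym2 V)}
    (hc : ∀ e ∈ F ∪ F', 0 ≤ c e) : cost c (F ∪ F') ≤ cost c F + cost c F' := by
  have := Finset.sum_union_inter (s₁ := F) (s₂ := F') (f := c)
  have h0 : 0 ≤ ∑ e ∈ F ∩ F', c e :=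
    Finset.sum_nonneg fun e he => hc e (Finset.mem_union_left _ (Finset.mem_inter.1 he).1)
  unfold cost
  linarith

theorem cost_union_sdiff (c : Sym2 V → ℝ) (F p : Finset (Sym2 V)) :
    cost c (F ∪ p) = cost c F + cost c (p \ F) := by
  unfold cost
  rw [← Finset.union_sdiff_self_eq_union, Finset.sum_union Finset.disjoint_sdiff]

/-- `u` can be joined to `v` inside `Fbar ∪ F` by edges whose cost outside `F` is at most `r`. -/
def Within (c : Sym2 V → ℝ) (Fbar F : Finset (Sym2 V)) (r : ℝ) (u v : V) : Prop :=
  ∃ q, q ⊆ Fbar ∪ F ∧ Conn q u v ∧ cost c (q \ F) ≤ r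

theorem Within.symm {c : Sym2 V → ℝ} {Fbar F : Finset (Sym2 V)} {r : ℝ} {u v : V}
    (h : Within c Fbar F r u v) : Within c Fbar F r v u := by
  obtain ⟨q, h1, h2, h3⟩ := h
  exact ⟨q, h1, h2.symm, h3⟩

theorem Within.le {c : Sym2 V → ℝ} {Fbar F : Finset (Sym2 V)} {r r' : ℝ} {u v : V}
    (h : Within c Fbar F r u v) (hr : r ≤ r') : Within c Fbar F r' u v := by
  obtain ⟨q, h1, h2, h3⟩ := h
  exact ⟨q, h1, h2, h3.trans hr⟩

theorem Within.trans {c : Sym2 V → ℝ} {Fbar F : Finset (Sym2 V)} {r r' : ℝ} {u v w : V}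
    (hc : ∀ e ∈ Fbar ∪ F, 0 ≤ c e)
    (h : Within c Fbar F r u v) (h' : Within c Fbar F r' v w) :
    Within c Fbar F (r + r') u w := by
  obtain ⟨q, h1, h2, h3⟩ := h
  obtain ⟨q', h1', h2', h3'⟩ := h'
  refine ⟨q ∪ q', Finset.union_subset h1 h1', (h2.mono Finset.subset_union_left).trans
    (h2'.mono Finset.subset_union_right), ?_⟩
  rw [Finset.union_sdiff_distrib]
  refine (cost_union_le fun e he => hc e ?_).trans (add_le_add h3 h3')
  rw [← Finset.union_sdiff_distrib] at he
  exact Finset.union_subset h1 h1' (Finset.mem_sdiff.1 he).1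

theorem Within.of_conn {c : Sym2 V → ℝ} {Fbar F : Finset (Sym2 V)} {u v : V}
    (h : Conn F u v) : Within c Fbar F 0 u v :=
  ⟨F, Finset.subset_union_right, h, by simp [cost]⟩

theorem Within.of_mem {c : Sym2 V → ℝ} {Fbar F : Finset (Sym2 V)} {u v : V}
    (hc : 0 ≤ c s(u, v)) (h : s(u, v) ∈ Fbar) : Within c Fbar F (c s(u, v)) u v := by
  refine ⟨{s(u, v)}, by simpa using Or.inl h, Conn.of_mem (by simp), ?_⟩
  by_cases hF : s(u, v) ∈ F
  · have : ({s(u, v)} : Finset (Sym2 V)) \ F = ∅ := by simpa using hF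
    simpa [this, cost] using hc
  · have : ({s(u, v)} : Finset (Sym2 V)) \ F = {s(u, v)} := by
      simpa [Finset.sdiff_eq_self_iff_disjoint] using hF
    simp [this, cost]

theorem Within.mono {c : Sym2 V → ℝ} {Fbar Fbar' F F' : Finset (Sym2 V)} {r : ℝ} {u v : V}
    (hc : ∀ e ∈ Fbar ∪ F, 0 ≤ c e) (h : Within c Fbar F r u v) (hb : Fbar ⊆ Fbar')
    (hF : F ⊆ F') : Within c Fbar' F' r u v := by
  obtain ⟨q, h1, h2, h3⟩ := h
  refine ⟨q, h1.trans (Finset.union_subset_union hb hF), h2, le_trans ?_ h3⟩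
  exact cost_mono (Finset.sdiff_subset_sdiff le_rfl hF) fun e he =>
    hc e (h1 (Finset.mem_sdiff.1 he).1)

/-! ### The number of components merged -/

/-- The number of elements of `U` minus the number of components of `(V, F)` that meet `U`. -/
def rank (F : Finset (Sym2 V)) (U : Finset V) : ℕ := U.card - (U.image (comp F)).card

theorem rank_le_card (F : Finset (Sym2 V)) (U : Finset V) : rank F U ≤ U.card := Nat.sub_le _ _

theorem rank_eq_zero_of_card_le_one {F : Finset (Sym2 V)} {U : Finset V} (h : U.card ≤ 1) :
    rank F U = 0 := by
  unfold rank
  rcases U.eq_empty_or_nonempty with rfl | hU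
  · simp
  · have := (hU.image (comp F)).card_pos
    omega

theorem rank_mono_right (F : Finset (Sym2 V)) {U U' : Finset V} (h : U ⊆ U') :
    rank F U ≤ rank F U' := by
  unfold rank
  have h1 : (U'.image (comp F)).card ≤ (U.image (comp F)).card + (U' \ U).card := by
    calc (U'.image (comp F)).card ≤ (U.image (comp F) ∪ (U' \ U).image (comp F)).card := by
          rw [← Finset.image_union, Finset.union_sdiff_of_subset h]
      _ ≤ _ := (Finset.card_union_le _ _).trans (Nat.add_le_add_left Finset.card_image_le _)
  have h2 := Finset.card_sdiff_add_card_eq_card h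
  have h3 : (U.image (comp F)).card ≤ U.card := Finset.card_image_le
  omega

theorem comp_eq_biUnion {F F' : Finset (Sym2 V)} (h : F ⊆ F') (u : V) :
    comp F' u = (comp F u).biUnion (comp F') := by
  ext w
  simp only [Finset.mem_biUnion, mem_comp]
  exact ⟨fun hw => ⟨u, Conn.refl F u, hw⟩, fun ⟨a, ha, hw⟩ => (ha.mono h).trans hw⟩

/-- Components of the larger edge set are unions of components of the smaller one, so the new
components are an image of the old ones. Their number cannot rise, and it falls as soon as this map
identifies two of them; this is all that `rank_mono_left` and `rank_lt` use. -/
theorem image_comp_eq {F F' : Finset (Sym2 V)} (h : F ⊆ F') (U : Finset V) :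
    U.image (comp F') = (U.image (comp F)).image (fun S => S.biUnion (comp F')) := by
  rw [Finset.image_image]
  exact Finset.image_congr fun u _ => comp_eq_biUnion h u

theorem rank_mono_left {F F' : Finset (Sym2 V)} (h : F ⊆ F') (U : Finset V) :
    rank F U ≤ rank F' U := by
  unfold rank
  have : (U.image (comp F')).card ≤ (U.image (comp F)).card := by
    rw [image_comp_eq h]
    exact Finset.card_image_le
  omega

theorem rank_lt {F F' : Finset (Sym2 V)} (h : F ⊆ F') {U : Finset V} {u w : V} (hu : u ∈ U)
    (hw : w ∈ U) (h1 : ¬ Conn F u w) (h2 : Conn F' u w) : rank F U + 1 ≤ rank F' U := by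
  unfold rank
  have h3 : (U.image (comp F')).card < (U.image (comp F)).card := by
    rw [image_comp_eq h]
    refine lt_of_le_of_ne Finset.card_image_le fun heq => h1 ?_
    have hinj := Finset.card_image_iff.1 heq
    have := hinj (Finset.mem_coe.2 (Finset.mem_image_of_mem _ hu))
      (Finset.mem_coe.2 (Finset.mem_image_of_mem _ hw))
      (by
        change (comp F u).biUnion (comp F') = (comp F w).biUnion (comp F')
        rw [← comp_eq_biUnion h, ← comp_eq_biUnion h, comp_eq_iff]
        exact h2)
    exact comp_eq_iff.1 this
  have h4 : (U.image (comp F)).card ≤ U.card := Finset.card_image_le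
  omega

/-! ### Proper functions -/

theorem eq_true_of_true_le {b : Bool} (h : true ≤ b) : b = true := Bool.le_iff_imp.1 h rfl

/-- A set closed under connection in `F` is a disjoint union of components, so the maximum property
passes the value `1` to one of them; the induction splits off one component at a time. -/
theorem IsProper.exists_comp {g : Finset V → Bool} (hg : IsProper g) (F : Finset (Sym2 V))
    {S : Finset V} (hS : ∀ u ∈ S, ∀ v, Conn F u v → v ∈ S) (h : g S = true) :
    ∃ v ∈ S, g (comp F v) = true := by
  induction hn : S.card using Nat.strong_induction_on generalizing S with
  | _ n ih =>
    have hne : S.Nonempty := by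
      rw [Finset.nonempty_iff_ne_empty]
      rintro rfl
      rw [hg.empty] at h
      exact Bool.false_ne_true h
    obtain ⟨v, hv⟩ := hne
    by_cases hgv : g (comp F v) = true
    · exact ⟨v, hv, hgv⟩
    have hsub : comp F v ⊆ S := fun w hw => hS v hv w (mem_comp.1 hw)
    have hgr : g (S \ comp F v) = true := by
      have := hg.union (comp F v) (S \ comp F v) Finset.disjoint_sdiff
      rw [Finset.union_sdiff_of_subset hsub, h] at this
      exact eq_true_of_true_le (by simpa [hgv] using this)
    have hlt : (S \ comp F v).card < n := by
      rw [← hn]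
      refine Finset.card_lt_card ⟨Finset.sdiff_subset, fun hh => ?_⟩
      exact (Finset.mem_sdiff.1 (hh hv)).2 (mem_comp.2 (Conn.refl F v))
    obtain ⟨w, hw, hgw⟩ := ih _ hlt (S := S \ comp F v) (fun a ha b hab => by
      rw [Finset.mem_sdiff, mem_comp] at ha ⊢
      exact ⟨hS a ha.1 b hab, fun hvb => ha.2 (hvb.trans hab.symm)⟩) hgr rfl
    exact ⟨w, (Finset.mem_sdiff.1 hw).1, hgw⟩

theorem IsProper.exists_terminal {g : Finset V → Bool} (hg : IsProper g) {S : Finset V}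
    (h : g S = true) : ∃ v ∈ S, v ∈ terminals g := by
  obtain ⟨v, hv, hgv⟩ := hg.exists_comp ∅ (S := S) (fun u hu v huv => by
    rwa [← conn_empty.1 huv]) h
  rw [comp_empty] at hgv
  exact ⟨v, hv, mem_terminals.2 hgv⟩

/-- The complement of `X` is the disjoint union of `Mᶜ` and `M \ X`. By symmetry it has value `1`,
so one of the two parts does. This shows that a moat with exactly one violated component of `F`
inside it is itself required. -/
theorem IsProper.eq_true_of_sdiff {g : Finset V → Bool} (hg : IsProper g) {X M : Finset V}
    (hXM : X ⊆ M) (hX : g X = true) (hd : g (M \ X) ≠ true) : g M = true := by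
  have h := hg.union Mᶜ (M \ X)
    (Finset.disjoint_of_subset_right Finset.sdiff_subset disjoint_compl_left)
  have h2 : Mᶜ ∪ (M \ X) = Xᶜ := by
    ext v
    have := @hXM v
    simp only [Finset.mem_union, Finset.mem_compl, Finset.mem_sdiff]
    tauto
  rw [h2, hg.compl, hg.compl, hX] at h
  exact eq_true_of_true_le (by simpa [hd] using h)

theorem cumul_eq_true {f : ℕ → Finset V → Bool} {i : ℕ} {S : Finset V} :
    cumul f i S = true ↔ ∃ k ≤ i, f k S = true := by
  constructor
  · intro h
    by_contra hcon
    push Not at hcon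
    have : cumul f i S ≤ false := by
      refine Finset.sup_le fun k hk => ?_
      have := hcon k (Nat.lt_succ_iff.1 (Finset.mem_range.1 hk))
      simp at this
      rw [this]
    rw [h] at this
    exact Bool.false_ne_true (eq_true_of_true_le this)
  · rintro ⟨k, hk, h⟩
    have : f k S ≤ cumul f i S :=
      Finset.le_sup (f := fun k => f k S) (Finset.mem_range.2 (Nat.lt_succ_iff.2 hk))
    rw [h] at this
    exact eq_true_of_true_le this

theorem isProper_cumul {f : ℕ → Finset V → Bool} (hf : ∀ i, IsProper (f i)) (i : ℕ) :
    IsProper (cumul f i) where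
  compl S := by
    rw [Bool.eq_iff_iff, cumul_eq_true, cumul_eq_true]
    simp only [(hf _).compl]
  empty := by
    rw [← Bool.not_eq_true, cumul_eq_true]
    simp [(hf _).empty]
  univ := by
    rw [← Bool.not_eq_true, cumul_eq_true]
    simp [(hf _).univ]
  union A B hAB := by
    rw [Bool.le_iff_imp]
    intro h
    obtain ⟨k, hk, h⟩ := cumul_eq_true.1 h
    have := (hf k).union A B hAB
    rw [h] at this
    have h2 : f k A = true ∨ f k B = true := by
      rcases le_max_iff.1 this with h | h
      · exact Or.inl (eq_true_of_true_le h)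
      · exact Or.inr (eq_true_of_true_le h)
    rcases h2 with h2 | h2
    · rw [cumul_eq_true.2 ⟨k, hk, h2⟩]; rfl
    · rw [cumul_eq_true.2 ⟨k, hk, h2⟩]; simp

theorem cumul_mono {f : ℕ → Finset V → Bool} {i : ℕ} {S : Finset V}
    (h : cumul f i S = true) : cumul f (i + 1) S = true := by
  obtain ⟨k, hk, h⟩ := cumul_eq_true.1 h
  exact cumul_eq_true.2 ⟨k, hk.trans (Nat.le_succ i), h⟩

theorem terminals_mono {g g' : Finset V → Bool} (h : ∀ S, g S = true → g' S = true) :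
    terminals g ⊆ terminals g' := fun _ hv =>
  mem_terminals.2 (h _ (mem_terminals.1 hv))

theorem feasible_cumul {G : SimpleGraph V} {f : ℕ → Finset V → Bool}
    (hfeas : ∀ i, Feasible G (f i) (edges G)) (i : ℕ) : Feasible G (cumul f i) (edges G) :=
  ⟨le_rfl, fun S hS => by
    obtain ⟨k, _, h⟩ := cumul_eq_true.1 hS
    exact (hfeas k).2 S h⟩

/-! ### Loads and cuts of a dual vector -/

/-- `∑_{S : e ∈ δ(S)} y_S`. -/
def LevelData.cut (G : SimpleGraph V) (d : LevelData V) (e : Sym2 V) : ℝ :=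
  ∑ S ∈ Finset.univ.filter (fun S : Finset V => e ∈ delta G S), d.y S

theorem LevelData.isTight_iff {G : SimpleGraph V} {c : Sym2 V → ℝ} {d : LevelData V}
    {e : Sym2 V} : d.IsTight G c e ↔ d.cut G e = c e := Iff.rfl

theorem LevelData.load_nonneg {d : LevelData V} (hy : ∀ S, 0 ≤ d.y S) (v : V) :
    0 ≤ d.load v :=
  Finset.sum_nonneg fun S _ => hy S

/-- A set cut by an edge contains one of its endpoints. Thus a tight edge costs at most the sum of
the two loads, which is what turns loads into distances. -/
theorem LevelData.cut_le_load (G : SimpleGraph V) {d : LevelData V} (hy : ∀ S, 0 ≤ d.y S)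
    (a b : V) : d.cut G s(a, b) ≤ d.load a + d.load b := by
  unfold LevelData.cut LevelData.load
  have h : Finset.univ.filter (fun S : Finset V => s(a, b) ∈ delta G S) ⊆
      Finset.univ.filter (fun S : Finset V => a ∈ S) ∪
        Finset.univ.filter (fun S : Finset V => b ∈ S) := by
    intro S hS
    rw [Finset.mem_filter, mem_delta] at hS
    simp only [Finset.mem_union, Finset.mem_filter, Finset.mem_univ, true_and]
    tauto
  refine (Finset.sum_le_sum_of_subset_of_nonneg h fun S _ _ => hy S).trans ?_
  have := Finset.sum_union_inter (s₁ := Finset.univ.filter (fun S : Finset V => a ∈ S))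
    (s₂ := Finset.univ.filter (fun S : Finset V => b ∈ S)) (f := d.y)
  have h0 : 0 ≤ ∑ S ∈ Finset.univ.filter (fun S : Finset V => a ∈ S) ∩
      Finset.univ.filter (fun S : Finset V => b ∈ S), d.y S := Finset.sum_nonneg fun S _ => hy S
  linarith

theorem LevelData.IsActiveMoat.eq_comp {g : Finset V → Bool} {j : ℤ} {d : LevelData V}
    {S : Finset V} (h : d.IsActiveMoat g j S) {v : V} (hv : v ∈ S) : S = comp d.Fbar v := by
  obtain ⟨⟨w, rfl⟩, _⟩ := h
  exact comp_eq_iff.2 (mem_comp.1 hv)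

/-- Moats are disjoint, so among the raised sets only the moat of `v` can contain `v`. -/
theorem LevelData.load_raise (g : Finset V → Bool) (j : ℤ) (d : LevelData V) (ε : ℝ) (v : V) :
    (d.raise g j ε).load v =
      d.load v + if d.IsActiveMoat g j (comp d.Fbar v) then ε else 0 := by
  have h1 : ∀ S, (d.raise g j ε).y S = d.y S + if d.IsActiveMoat g j S then ε else 0 := by
    intro S
    change (if d.IsActiveMoat g j S then d.y S + ε else d.y S) = _
    split_ifs <;> simp
  unfold LevelData.load
  simp only [h1]
  rw [Finset.sum_add_distrib]
  congr 1
  refine Finset.sum_eq_single (comp d.Fbar v) ?_ ?_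
  · intro S hS hne
    rw [if_neg]
    intro hact
    exact hne (hact.eq_comp (Finset.mem_filter.1 hS).2)
  · intro h
    exact absurd (by simp [mem_comp, Conn.refl]) h

theorem LevelData.cut_raise (G : SimpleGraph V) (g : Finset V → Bool) (j : ℤ)
    (d : LevelData V) (ε : ℝ) (e : Sym2 V) :
    (d.raise g j ε).cut G e = d.cut G e + ((Finset.univ.filter (fun S : Finset V =>
      e ∈ delta G S)).filter (fun S => d.IsActiveMoat g j S)).card * ε := by
  have h1 : ∀ S, (d.raise g j ε).y S = d.y S + if d.IsActiveMoat g j S then ε else 0 := by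
    intro S
    change (if d.IsActiveMoat g j S then d.y S + ε else d.y S) = _
    split_ifs <;> simp
  unfold LevelData.cut
  simp only [h1]
  rw [Finset.sum_add_distrib, ← Finset.sum_filter, Finset.sum_const, nsmul_eq_mul]

/-- An edge of `F̄` never crosses a moat, so a tight edge stays tight once it has been added. -/
theorem LevelData.cut_raise_of_mem (G : SimpleGraph V) (g : Finset V → Bool) (j : ℤ)
    (d : LevelData V) (ε : ℝ) {e : Sym2 V} (he : e ∈ d.Fbar) :
    (d.raise g j ε).cut G e = d.cut G e := by
  rw [LevelData.cut_raise]
  have : (Finset.univ.filter (fun S : Finset V =>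
      e ∈ delta G S)).filter (fun S => d.IsActiveMoat g j S) = ∅ := by
    rw [Finset.eq_empty_iff_forall_notMem]
    intro S hS
    obtain ⟨hS, ⟨⟨v, rfl⟩, _⟩⟩ := Finset.mem_filter.1 hS
    have := delta_comp_inter G d.Fbar v
    exact Finset.notMem_empty e (this ▸ Finset.mem_inter.2 ⟨(Finset.mem_filter.1 hS).2, he⟩)
  simp [this]

/-! ### The invariant of one level -/

/-- The facts about a level `j` that hold throughout the algorithm. `Q` is the set of terminals
that have been active at the level; `W` contains one terminal of full load `2 ^ j` for each moat
that has reached its limit by growth. -/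
structure LevelInv (G : SimpleGraph V) (c : Sym2 V → ℝ) (g : Finset V → Bool) (j : ℤ)
    (F : Finset (Sym2 V)) (d : LevelData V) (Q W : Finset V) : Prop where
  Fbar_sub : d.Fbar ⊆ edges G
  y_nonneg : ∀ S, 0 ≤ d.y S
  y_supp : ∀ S, d.y S ≠ 0 → g S = true
  y_conn : ∀ S, d.y S ≠ 0 → ∀ u ∈ S, ∀ v ∈ S, Conn d.Fbar u v
  cut_le : ∀ e ∈ edges G, d.cut G e ≤ c e
  tight : ∀ e ∈ d.Fbar, e ∈ F ∨ d.IsTight G c e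
  load_le : ∀ v, d.load v ≤ (2 : ℝ) ^ j
  Q_sub : Q ⊆ terminals g
  W_sub : W ⊆ Q
  W_load : ∀ w ∈ W, d.load w = (2 : ℝ) ^ j
  W_disj : ∀ S, d.y S ≠ 0 → ∀ w ∈ W, ∀ w' ∈ W, w ∈ S → w' ∈ S → w = w'
  W_cover : ∀ v, d.load v = (2 : ℝ) ^ j → ∃ w ∈ W, Conn d.Fbar v w
  -- Loads act as a potential for distances modulo `F`. Growth keeps the bound, since it changes
  -- `load t` and `load v` equally within a moat. A moat without elements of `Q` has never grown,
  -- and all its vertices are at distance `0` from each other.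
  radius : ∀ v, (∃ t ∈ Q, Conn d.Fbar v t ∧ Within c d.Fbar F (d.load t - d.load v) v t) ∨
    ((∀ t ∈ Q, ¬ Conn d.Fbar v t) ∧ d.load v = 0 ∧
      ∀ u, Conn d.Fbar v u → Within c d.Fbar F 0 v u)

namespace LevelInv

variable {G : SimpleGraph V} {c : Sym2 V → ℝ} {g : Finset V → Bool} {j : ℤ}
  {F : Finset (Sym2 V)} {d : LevelData V} {Q W : Finset V}

theorem init (hc : ∀ e ∈ edges G, 0 ≤ c e) :
    LevelInv G c g j F { y := fun _ => 0, Fbar := ∅, prev := ∅ } ∅ ∅ := by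
  refine ⟨by simp, by simp, by simp, by simp, ?_, by simp, ?_, by simp, by simp, by simp,
    by simp, ?_, ?_⟩
  · intro e he
    simpa [LevelData.cut] using hc e he
  · intro v
    simp only [LevelData.load, Finset.sum_const_zero]
    positivity
  · intro v hv
    simp only [LevelData.load, Finset.sum_const_zero] at hv
    exact absurd hv.symm (by positivity)
  · intro v
    refine Or.inr ⟨by simp, by simp [LevelData.load], fun u hu => ?_⟩
    rw [conn_empty.1 hu]
    exact Within.of_conn (Conn.refl _ _)

theorem with_prev (h : LevelInv G c g j F d Q W) (P : Finset V) :
    LevelInv G c g j F { d with prev := P } Q W :=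
  ⟨h.1, h.2, h.3, h.4, h.5, h.6, h.7, h.8, h.9, h.10, h.11, h.12, h.13⟩

/-- Old duals stay valid under a larger requirement function: `g` enters only as an upper bound for
the support and for `Q`. -/
theorem mono_g (h : LevelInv G c g j F d Q W) {g' : Finset V → Bool}
    (hg : ∀ S, g S = true → g' S = true) : LevelInv G c g' j F d Q W :=
  { h with
    y_supp := fun S hS => hg S (h.y_supp S hS)
    Q_sub := h.Q_sub.trans (terminals_mono hg) }

theorem cost_nonneg (h : LevelInv G c g j F d Q W) (hc : ∀ e ∈ edges G, 0 ≤ c e)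
    (hF : F ⊆ edges G) : ∀ e ∈ d.Fbar ∪ F, 0 ≤ c e :=
  fun e he => hc e (Finset.union_subset h.Fbar_sub hF he)

theorem mono_F (h : LevelInv G c g j F d Q W) (hc : ∀ e ∈ edges G, 0 ≤ c e)
    (hF : F ⊆ edges G) {F' : Finset (Sym2 V)} (hF' : F ⊆ F') :
    LevelInv G c g j F' d Q W :=
  { h with
    tight := fun e he => (h.tight e he).imp_left fun h => hF' h
    radius := fun v => by
      have hn := h.cost_nonneg hc hF
      rcases h.radius v with ⟨t, ht, h1, h2⟩ | ⟨h1, h2, h3⟩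
      · exact Or.inl ⟨t, ht, h1, h2.mono hn le_rfl hF'⟩
      · exact Or.inr ⟨h1, h2, fun u hu => (h3 u hu).mono hn le_rfl hF'⟩ }

theorem mono_Q (h : LevelInv G c g j F d Q W) {Q' : Finset V} (hQ : Q ⊆ Q')
    (hQ' : Q' ⊆ terminals g) : LevelInv G c g j F d Q' W :=
  { h with
    Q_sub := hQ'
    W_sub := h.W_sub.trans hQ
    radius := fun v => by
      rcases h.radius v with ⟨t, ht, h1, h2⟩ | ⟨h1, h2, h3⟩
      · exact Or.inl ⟨t, hQ ht, h1, h2⟩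
      · by_cases hex : ∃ t ∈ Q', Conn d.Fbar v t
        · obtain ⟨t, ht, hvt⟩ := hex
          refine Or.inl ⟨t, ht, hvt, (h3 t hvt).le ?_⟩
          have := LevelData.load_nonneg h.y_nonneg t
          linarith
        · push Not at hex
          exact Or.inr ⟨hex, h2, h3⟩ }

theorem within_edge (h : LevelInv G c g j F d Q W) (hc : ∀ e ∈ edges G, 0 ≤ c e) {a b : V}
    (he : s(a, b) ∈ edges G) (ht : s(a, b) ∈ F ∨ d.IsTight G c s(a, b))
    {Fbar : Finset (Sym2 V)} (hF : s(a, b) ∈ Fbar) :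
    Within c Fbar F (d.load a + d.load b) a b := by
  rcases ht with ht | ht
  · refine (Within.of_conn (Conn.of_mem ht)).le ?_
    have h1 := LevelData.load_nonneg h.y_nonneg a
    have h2 := LevelData.load_nonneg h.y_nonneg b
    linarith
  · refine (Within.of_mem (hc _ he) hF).le ?_
    rw [← LevelData.isTight_iff.1 ht]
    exact LevelData.cut_le_load G h.y_nonneg a b

/-- Only a vertex whose moat has no element of `Q` needs a new argument. Its side of `e` has load
`0` and diameter `0`, so it can reach the other side by paying for `e` alone. -/
theorem addEdge (h : LevelInv G c g j F d Q W) (hc : ∀ e ∈ edges G, 0 ≤ c e)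
    (hF : F ⊆ edges G) {e : Sym2 V} (he : e ∈ edges G) (ht : e ∈ F ∨ d.IsTight G c e) :
    LevelInv G c g j F { d with Fbar := insert e d.Fbar } Q W := by
  have hn := h.cost_nonneg hc hF
  have hsub : d.Fbar ⊆ insert e d.Fbar := Finset.subset_insert _ _
  have hn' : ∀ e' ∈ insert e d.Fbar ∪ F, 0 ≤ c e' := fun e' he' =>
    hc e' (Finset.union_subset (Finset.insert_subset he h.Fbar_sub) hF he')
  refine ⟨Finset.insert_subset he h.Fbar_sub, h.2, h.3, fun S hS u hu v hv =>
    (h.y_conn S hS u hu v hv).mono hsub, h.5, ?_, h.7, h.8, h.9, h.10, h.11, ?_, ?_⟩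
  · intro e' he'
    rcases Finset.mem_insert.1 he' with rfl | he'
    · exact ht
    · exact h.tight e' he'
  · intro v hv
    obtain ⟨w, hw, hvw⟩ := h.W_cover v hv
    exact ⟨w, hw, hvw.mono hsub⟩
  · intro v
    change (∃ t ∈ Q, Conn (insert e d.Fbar) v t ∧
      Within c (insert e d.Fbar) F (d.load t - d.load v) v t) ∨
      ((∀ t ∈ Q, ¬ Conn (insert e d.Fbar) v t) ∧ d.load v = 0 ∧
      ∀ u, Conn (insert e d.Fbar) v u → Within c (insert e d.Fbar) F 0 v u)
    rcases h.radius v with ⟨t, htQ, h1, h2⟩ | ⟨h1, h2, h3⟩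
    · exact Or.inl ⟨t, htQ, h1.mono hsub, h2.mono hn hsub le_rfl⟩
    -- the moat of `v` contains no element of `Q`
    have key : ∀ a b u, s(a, b) = e → Conn d.Fbar v a → Conn d.Fbar b u →
        (∀ t ∈ Q, ¬ Conn d.Fbar b t) → Within c (insert e d.Fbar) F 0 v u := by
      intro a b u hab hva hbu hb
      subst hab
      have hab := h.within_edge hc he ht (Fbar := insert s(a, b) d.Fbar)
        (Finset.mem_insert_self _ _)
      have hla : d.load a = 0 := by
        rcases h.radius a with ⟨t, htQ, h4, _⟩ | ⟨_, h4, _⟩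
        · exact absurd (hva.trans h4) (h1 t htQ)
        · exact h4
      rcases h.radius b with ⟨t, htQ, h4, _⟩ | ⟨_, h4, h5⟩
      · exact absurd h4 (hb t htQ)
      have := (((h3 a hva).mono hn hsub le_rfl).trans hn' hab).trans hn'
        ((h5 u hbu).mono hn hsub le_rfl)
      refine this.le ?_
      rw [hla, h4]
      norm_num
    -- The route costs `0` to `a`, at most `0 + load b` for the edge, and `load t' - load b` from
    -- `b` to `t'`: in total `load t' = load t' - load v`.
    have key2 : ∀ a b t, s(a, b) = e → Conn d.Fbar v a → t ∈ Q → Conn d.Fbar b t →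
        ∃ t ∈ Q, Conn (insert e d.Fbar) v t ∧
          Within c (insert e d.Fbar) F (d.load t - d.load v) v t := by
      intro a b t hab hva htQ hbt
      subst hab
      have hab := h.within_edge hc he ht (Fbar := insert s(a, b) d.Fbar)
        (Finset.mem_insert_self _ _)
      have hla : d.load a = 0 := by
        rcases h.radius a with ⟨t, htQ, h4, _⟩ | ⟨_, h4, _⟩
        · exact absurd (hva.trans h4) (h1 t htQ)
        · exact h4
      rcases h.radius b with ⟨t', htQ', h4, h5⟩ | ⟨h4, _, _⟩
      · refine ⟨t', htQ', ((hva.mono hsub).trans (Conn.of_mem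
          (Finset.mem_insert_self _ _))).trans (h4.mono hsub), ?_⟩
        refine ((((h3 a hva).mono hn hsub le_rfl).trans hn' hab).trans hn'
          (h5.mono hn hsub le_rfl)).le ?_
        rw [hla, h2]
        linarith
      · exact absurd hbt (h4 t htQ)
    have hsplit : ∀ u, Conn (insert e d.Fbar) v u → Conn d.Fbar v u ∨
        ∃ a b, s(a, b) = e ∧ Conn d.Fbar v a ∧ Conn d.Fbar b u := by
      intro u hu
      induction e using Sym2.ind with
      | _ a b =>
        rcases hu.of_insert with hu | ⟨h4, h5⟩ | ⟨h4, h5⟩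
        · exact Or.inl hu
        · exact Or.inr ⟨a, b, rfl, h4, h5⟩
        · exact Or.inr ⟨b, a, Sym2.eq_swap, h4, h5⟩
    by_cases hex : ∃ t ∈ Q, Conn (insert e d.Fbar) v t
    · obtain ⟨t, htQ, hvt⟩ := hex
      rcases hsplit t hvt with hvt | ⟨a, b, hab, hva, hbt⟩
      · exact absurd hvt (h1 t htQ)
      · exact Or.inl (key2 a b t hab hva htQ hbt)
    · push Not at hex
      refine Or.inr ⟨hex, h2, fun u hu => ?_⟩
      rcases hsplit u hu with hvu | ⟨a, b, hab, hva, hbu⟩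
      · exact (h3 u hvu).mono hn hsub le_rfl
      · refine key a b u hab hva hbu fun t htQ hbt => hex t htQ ?_
        subst hab
        exact ((hva.mono hsub).trans (Conn.of_mem (Finset.mem_insert_self _ _))).trans
          (hbt.mono hsub)

/-- A terminal that shares its moat with an element of `Q` from which it is separated in `F` is
close to such an element. -/
theorem exists_near (h : LevelInv G c g j F d Q W) (hc : ∀ e ∈ edges G, 0 ≤ c e)
    (hF : F ⊆ edges G) {s₁ s₂ : V} (hs₂ : s₂ ∈ Q) (hbar : Conn d.Fbar s₁ s₂)
    (hnot : ¬ Conn F s₁ s₂) :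
    ∃ t ∈ Q, Conn d.Fbar s₁ t ∧ ¬ Conn F s₁ t ∧
      Within c d.Fbar F (2 * (2 : ℝ) ^ j) s₁ t := by
  by_contra hcon
  push Not at hcon
  have hn := h.cost_nonneg hc hF
  have hpos : (0 : ℝ) < (2 : ℝ) ^ j := by positivity
  have hl0 := LevelData.load_nonneg h.y_nonneg
  have near : ∀ v, Conn d.Fbar s₁ v →
      ∃ t ∈ Q, Conn d.Fbar v t ∧ Within c d.Fbar F (d.load t - d.load v) v t := by
    intro v hv
    rcases h.radius v with h1 | ⟨h1, _⟩
    · exact h1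
    · exact absurd (hv.symm.trans hbar) (h1 s₂ hs₂)
  -- Walk from `s₁` to `s₂` in `F̄`, keeping a nearby element of `Q` in the `F`-component of `s₁`.
  -- If it changes component across an edge `ab`, the detour costs at most `(load t - load a) +
  -- (load a + load b) + (load t' - load b) ≤ 2 * 2 ^ j`, against the assumption. At the end `s₂`
  -- itself is within `2 ^ j` of `s₁`.
  have main : ∃ t ∈ Q, Conn F s₁ t ∧ Within c d.Fbar F (d.load t - d.load s₂) s₂ t := by
    refine hbar.induction (motive := fun v => ∃ t ∈ Q, Conn F s₁ t ∧
      Within c d.Fbar F (d.load t - d.load v) v t) ?_ ?_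
    · obtain ⟨t, ht, h1, h2⟩ := near s₁ (Conn.refl _ _)
      refine ⟨t, ht, ?_, h2⟩
      by_contra h3
      refine hcon t ht h1 h3 (h2.le ?_)
      linarith [h.load_le t, hl0 s₁]
    · rintro a b ha hab ⟨t, ht, h1, h2⟩
      have hb := ha.trans (Conn.of_mem hab)
      obtain ⟨t', ht', h3, h4⟩ := near b hb
      refine ⟨t', ht', ?_, h4⟩
      by_contra h5
      refine hcon t' ht' (hb.trans h3) h5 ?_
      have h6 := h.within_edge hc (h.Fbar_sub hab) (h.tight _ hab) hab
      refine ((((Within.of_conn h1).trans hn h2.symm).trans hn h6).trans hn h4).le ?_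
      linarith [h.load_le t, h.load_le t']
  obtain ⟨t, ht, h1, h2⟩ := main
  refine hcon s₂ hs₂ hbar hnot (((Within.of_conn h1).trans hn h2.symm).le ?_)
  linarith [h.load_le t, hl0 s₂]

/-- Weak duality: the moats at their limit bound the cost of every feasible solution. -/
theorem mul_card_le_cost (h : LevelInv G c g j F d Q W) {H : Finset (Sym2 V)}
    (hH : Feasible G g H) : (2 : ℝ) ^ j * W.card ≤ cost c H := by
  have h1 : (2 : ℝ) ^ j * W.card = ∑ w ∈ W, ∑ S : Finset V, if w ∈ S then d.y S else 0 := by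
    rw [mul_comm, ← nsmul_eq_mul, ← Finset.sum_const]
    refine Finset.sum_congr rfl fun w hw => ?_
    rw [← h.W_load w hw, LevelData.load, Finset.sum_filter]
  -- A set in the support contains at most one element of `W`, while `H` crosses it at least once.
  have h2 : ∀ S : Finset V, (∑ w ∈ W, if w ∈ S then d.y S else 0) ≤
      ∑ e ∈ H, if e ∈ delta G S then d.y S else 0 := by
    intro S
    rw [← Finset.sum_filter, ← Finset.sum_filter, Finset.sum_const, Finset.sum_const,
      nsmul_eq_mul, nsmul_eq_mul]
    by_cases hS : d.y S = 0
    · simp [hS]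
    · refine mul_le_mul_of_nonneg_right ?_ (h.y_nonneg S)
      have h3 : (W.filter (fun w => w ∈ S)).card ≤ 1 := by
        rw [Finset.card_le_one]
        intro a ha b hb
        rw [Finset.mem_filter] at ha hb
        exact h.W_disj S hS a ha.1 b hb.1 ha.2 hb.2
      have h4 := hH.2 S (h.y_supp S hS)
      have h5 : H.filter (fun e => e ∈ delta G S) = delta G S ∩ H := by
        ext e
        simp [and_comm]
      rw [h5]
      exact_mod_cast h3.trans h4
  rw [h1, Finset.sum_comm]
  refine (Finset.sum_le_sum fun S _ => h2 S).trans ?_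
  rw [Finset.sum_comm]
  refine Finset.sum_le_sum fun e he => ?_
  rw [← Finset.sum_filter]
  exact h.cut_le e (hH.1 he)

theorem mul_card_le_opt (h : LevelInv G c g j F d Q W) (hE : Feasible G g (edges G)) :
    (2 : ℝ) ^ j * W.card ≤ opt G c g := by
  refine le_csInf ⟨_, edges G, hE, rfl⟩ ?_
  rintro x ⟨H, hH, rfl⟩
  exact h.mul_card_le_cost hH

/-- Growth of the active dual variables, as long as no dual constraint and no limit is exceeded. -/
theorem raise (h : LevelInv G c g j F d Q W) {ε : ℝ} (hε : 0 ≤ ε)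
    (hmeet : ∀ S, d.IsActiveMoat g j S → ∃ t ∈ Q, t ∈ S)
    (hcut : ∀ e ∈ edges G, (d.raise g j ε).cut G e ≤ c e)
    (hlim : ∀ s ∈ Q, (d.raise g j ε).load s ≤ (2 : ℝ) ^ j) :
    ∃ W', W ⊆ W' ∧ LevelInv G c g j F (d.raise g j ε) Q W' := by
  have hload := LevelData.load_raise g j d ε
  have hy : ∀ S, (d.raise g j ε).y S = if d.IsActiveMoat g j S then d.y S + ε else d.y S :=
    fun S => rfl
  have hsame : ∀ u v, Conn d.Fbar u v →
      (d.raise g j ε).load u - d.load u = (d.raise g j ε).load v - d.load v := by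
    intro u v huv
    rw [hload, hload, comp_eq_iff.2 huv]
    ring
  have hWn : ∀ S, d.IsActiveMoat g j S → ∀ w ∈ W, w ∉ S := fun S hS w hw hwS =>
    hS.2.2 ⟨w, hwS, h.Q_sub (h.W_sub hw), h.W_load w hw⟩
  have hradius : ∀ v, (∃ t ∈ Q, Conn d.Fbar v t ∧
      Within c d.Fbar F ((d.raise g j ε).load t - (d.raise g j ε).load v) v t) ∨
    ((∀ t ∈ Q, ¬ Conn d.Fbar v t) ∧ (d.raise g j ε).load v = 0 ∧
      ∀ u, Conn d.Fbar v u → Within c d.Fbar F 0 v u) := by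
    intro v
    rcases h.radius v with ⟨t, ht, h1, h2⟩ | ⟨h1, h2, h3⟩
    · exact Or.inl ⟨t, ht, h1, h2.le (by linarith [hsame v t h1])⟩
    · refine Or.inr ⟨h1, ?_, h3⟩
      rw [hload, if_neg, h2, add_zero]
      intro hact
      obtain ⟨t, ht, htS⟩ := hmeet _ hact
      exact h1 t ht (mem_comp.1 htS)
  -- Distances are nonnegative, so loads in a moat are dominated by loads of elements of `Q`; this
  -- is why the limit is assumed only on `Q`.
  have hle : ∀ v t, Within c d.Fbar F ((d.raise g j ε).load t - (d.raise g j ε).load v) v t →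
      (∀ e ∈ d.Fbar, 0 ≤ c e) → (d.raise g j ε).load v ≤ (d.raise g j ε).load t := by
    rintro v t ⟨q, hq, _, h3⟩ hc0
    have : 0 ≤ cost c (q \ F) := Finset.sum_nonneg fun e he => by
      rw [Finset.mem_sdiff] at he
      rcases Finset.mem_union.1 (hq he.1) with h' | h'
      · exact hc0 e h'
      · exact absurd h' he.2
    linarith
  have hc0 : ∀ e ∈ d.Fbar, 0 ≤ c e := fun e he =>
    (Finset.sum_nonneg fun S _ => h.y_nonneg S).trans (h.cut_le e (h.Fbar_sub he))
  have hyn : ∀ S, 0 ≤ (d.raise g j ε).y S := by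
    intro S
    rw [hy]
    have := h.y_nonneg S
    split_ifs <;> linarith
  have hyc : ∀ S, (d.raise g j ε).y S ≠ 0 → ∀ u ∈ S, ∀ v ∈ S, Conn d.Fbar u v := by
    intro S hS u hu v hv
    by_cases hact : d.IsActiveMoat g j S
    · have := hact.eq_comp hu
      rw [this] at hv
      exact mem_comp.1 hv
    · rw [hy, if_neg hact] at hS
      exact h.y_conn S hS u hu v hv
  have hll : ∀ v, (d.raise g j ε).load v ≤ (2 : ℝ) ^ j := by
    intro v
    rcases hradius v with ⟨t, ht, h1, h2⟩ | ⟨_, h2, _⟩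
    · exact (hle v t h2 hc0).trans (hlim t ht)
    · rw [h2]
      positivity
  -- a maximal extension of `W`
  let valid : Finset V → Prop := fun W' => W ⊆ W' ∧ W' ⊆ Q ∧
    (∀ w ∈ W', (d.raise g j ε).load w = (2 : ℝ) ^ j) ∧
    ∀ S, (d.raise g j ε).y S ≠ 0 → ∀ w ∈ W', ∀ w' ∈ W', w ∈ S → w' ∈ S → w = w'
  have hvalid : valid W := by
    refine ⟨le_rfl, h.W_sub, fun w hw => ?_, fun S hS w hw w' hw' hwS hwS' => ?_⟩
    · rw [hload, if_neg, add_zero, h.W_load w hw]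
      exact fun hact => hWn _ hact w hw (mem_comp.2 (Conn.refl _ _))
    · by_cases hact : d.IsActiveMoat g j S
      · exact absurd hwS (hWn S hact w hw)
      · rw [hy, if_neg hact] at hS
        exact h.W_disj S hS w hw w' hw' hwS hwS'
  obtain ⟨W', hW', hmax⟩ : ∃ W', valid W' ∧ ∀ W'', valid W'' → W''.card ≤ W'.card := by
    obtain ⟨W', hW', hmax⟩ := Finset.exists_max_image
      (Finset.univ.filter (fun W' : Finset V => valid W')) Finset.card
      ⟨W, Finset.mem_filter.2 ⟨Finset.mem_univ _, hvalid⟩⟩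
    exact ⟨W', (Finset.mem_filter.1 hW').2, fun W'' hW'' =>
      hmax W'' (Finset.mem_filter.2 ⟨Finset.mem_univ _, hW''⟩)⟩
  obtain ⟨h1, h2, h3, h4⟩ := hW'
  refine ⟨W', h1, h.Fbar_sub, hyn, ?_, hyc, hcut, ?_, hll, h.Q_sub, h2, h3, h4, ?_, hradius⟩
  · intro S hS
    by_cases hact : d.IsActiveMoat g j S
    · exact hact.2.1
    · rw [hy, if_neg hact] at hS
      exact h.y_supp S hS
  · intro e he
    refine (h.tight e he).imp_right fun ht => ?_
    rw [LevelData.isTight_iff] at ht ⊢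
    rw [LevelData.cut_raise_of_mem G g j d ε he, ht]
  · intro v hv
    by_contra hcon
    push Not at hcon
    change ∀ w ∈ W', ¬ Conn d.Fbar v w at hcon
    -- The element of `Q` near a full vertex is full as well. If the moat had no element of `W'`, it
    -- could be added, since every set of the support lies inside one moat; this contradicts
    -- maximality.
    obtain ⟨t, ht, hvt, htl⟩ : ∃ t ∈ Q, Conn d.Fbar v t ∧
        (d.raise g j ε).load t = (2 : ℝ) ^ j := by
      rcases hradius v with ⟨t, ht, h5, h6⟩ | ⟨_, h5, _⟩
      · exact ⟨t, ht, h5, le_antisymm (hll t) (hv ▸ hle v t h6 hc0)⟩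
      · rw [h5] at hv
        exact absurd hv.symm (by positivity)
    have htW : t ∉ W' := fun htW => hcon t htW hvt
    have hsep : ∀ S, (d.raise g j ε).y S ≠ 0 → t ∈ S → ∀ w ∈ W', w ∉ S :=
      fun S hS htS w hw hwS => hcon w hw (hvt.trans (hyc S hS t htS w hwS))
    have := hmax (insert t W') ⟨h1.trans (Finset.subset_insert _ _),
      Finset.insert_subset ht h2, ?_, ?_⟩
    · rw [Finset.card_insert_of_notMem htW] at this
      omega
    · intro w hw
      rcases Finset.mem_insert.1 hw with rfl | hw
      · exact htl
      · exact h3 w hw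
    · intro S hS w hw w' hw' hwS hwS'
      rcases Finset.mem_insert.1 hw with rfl | hwW
      · rcases Finset.mem_insert.1 hw' with rfl | hwW'
        · rfl
        · exact absurd hwS' (hsep S hS hwS w' hwW')
      · rcases Finset.mem_insert.1 hw' with rfl | hwW'
        · exact absurd hwS (hsep S hS hwS' w hwW)
        · exact h4 S hS w hwW w' hwW' hwS hwS'

end LevelInv

/-! ### The invariant of the work at one level -/

/-- `A` consists of active terminals for the solution `F`, and meets every violated component. -/
structure ActiveInv (G : SimpleGraph V) (g : Finset V → Bool) (F : Finset (Sym2 V))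
    (A : Finset V) : Prop where
  F_sub : F ⊆ edges G
  sub : A ⊆ activeTerminals G g F
  cover : ∀ v, g (comp F v) = true → ∃ a ∈ A, Conn F v a

theorem activeInv_activeTerminals {G : SimpleGraph V} {g : Finset V → Bool} (hg : IsProper g)
    {F : Finset (Sym2 V)} (hF : F ⊆ edges G) : ActiveInv G g F (activeTerminals G g F) where
  F_sub := hF
  sub := le_rfl
  cover v hv := by
    obtain ⟨a, ha, hat⟩ := hg.exists_terminal hv
    refine ⟨a, mem_activeTerminals.2 ⟨hat, ?_⟩, mem_comp.1 ha⟩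
    rwa [← comp_eq_iff.2 (mem_comp.1 ha)]

/-- A violated component of `F ∪ p` contains a violated component of `F`, whose active terminal
remains active. So discarding satisfied terminals never leaves a violated component without an
element of `A`. -/
theorem ActiveInv.union {G : SimpleGraph V} {g : Finset V → Bool} (hg : IsProper g)
    {F p : Finset (Sym2 V)} {A : Finset V} (h : ActiveInv G g F A) (hp : p ⊆ edges G) :
    ActiveInv G g (F ∪ p) (A ∩ activeTerminals G g (F ∪ p)) where
  F_sub := Finset.union_subset h.F_sub hp
  sub := Finset.inter_subset_right
  cover v hv := by
    have hsub : F ⊆ F ∪ p := Finset.subset_union_left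
    obtain ⟨u, hu, hgu⟩ := hg.exists_comp F (S := comp (F ∪ p) v) (fun a ha b hab =>
      mem_comp.2 ((mem_comp.1 ha).trans (hab.mono hsub))) hv
    obtain ⟨a, ha, hua⟩ := h.cover u hgu
    have hva := (mem_comp.1 hu).trans (hua.mono hsub)
    refine ⟨a, Finset.mem_inter.2 ⟨ha, mem_activeTerminals.2
      ⟨(mem_activeTerminals.1 (h.sub ha)).1, ?_⟩⟩, hva⟩
    rwa [← comp_eq_iff.2 hva]

theorem ActiveInv.feasible {G : SimpleGraph V} {g : Finset V → Bool} (hg : IsProper g)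
    {F : Finset (Sym2 V)} (h : ActiveInv G g F ∅) : Feasible G g F := by
  refine ⟨h.F_sub, fun S hS => ?_⟩
  by_contra hcon
  have h0 : delta G S ∩ F = ∅ := by
    rw [← Finset.card_eq_zero]
    omega
  obtain ⟨v, hv, hgv⟩ := hg.exists_comp F (S := S) (fun u hu v huv => by
    refine huv.induction (motive := fun v => v ∈ S) hu fun a b _ hab ha => ?_
    by_contra hb
    exact Finset.notMem_empty s(a, b) (h0 ▸ Finset.mem_inter.2
      ⟨mem_delta.2 ⟨h.F_sub hab, Or.inl ⟨ha, hb⟩⟩, hab⟩)) hS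
  obtain ⟨a, ha, _⟩ := h.cover v hgv
  exact Finset.notMem_empty a ha

/-- The facts about the work at level `j` that hold in both of its phases. `F₀`, `A₀` are the
solution and the active terminals at its beginning. -/
structure RunInv (G : SimpleGraph V) (c : Sym2 V → ℝ) (g : Finset V → Bool) (j : ℤ)
    (F₀ : Finset (Sym2 V)) (A₀ Q : Finset V) (x : Config V) : Prop where
  F_le : F₀ ⊆ x.F
  active : ActiveInv G g x.F x.A
  A_sub : x.A ⊆ A₀
  Aj_sub : x.Aj ⊆ x.A
  A₀_sub : A₀ ⊆ Q
  Q_eq : x.Aj ∪ x.lev.prev = Q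
  Q_sub : Q ⊆ terminals g
  -- This field and the next two serve the existence of a time step: they show that levels that are
  -- low enough, or reached with no active terminal, change nothing.
  A_eq : x.F = F₀ → x.A = A₀
  F_eq : A₀ = ∅ → x.F = F₀
  built_tight : ∀ e ∈ x.F, e ∈ F₀ ∨ (e ∈ x.lev.Fbar ∧ x.lev.IsTight G c e)
  -- Here `m` counts purchases. The set `U` is left free so that the same count applies to all
  -- terminals and to every `W k` with `k < j`.
  progress : ∃ m : ℕ, cost c x.F ≤ cost c F₀ + m * (2 * (2 : ℝ) ^ j) ∧
    ∀ U : Finset V, (∀ s ∈ Q, ∃ w ∈ U, Conn F₀ s w) → rank F₀ U + m ≤ rank x.F U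

section

variable {G : SimpleGraph V} {c : Sym2 V → ℝ} {g : Finset V → Bool} {j : ℤ}
  {F₀ : Finset (Sym2 V)} {A₀ Q W : Finset V} {x x' : Config V}

theorem RunInv.connect (h : RunInv G c g j F₀ A₀ Q x) (hg : IsProper g)
    (hc : ∀ e ∈ edges G, 0 ≤ c e) {Q' : Finset V} (hQ' : Q' ⊆ Q)
    (hl : LevelInv G c g j x.F x.lev Q' W) (hx : Connect G c g Q' x x') :
    RunInv G c g j F₀ A₀ Q x' := by
  obtain ⟨s₁, s₂, p, ⟨hs₁, hs₂, hbar, hnot⟩, hp, hmin, rfl⟩ := hx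
  have hF := h.active.F_sub
  have hpE : p ⊆ edges G := hp.subset.trans (Finset.union_subset hl.Fbar_sub hF)
  have hsub : x.F ⊆ x.F ∪ p := Finset.subset_union_left
  have hcon : Conn (x.F ∪ p) s₁ s₂ := hp.conn.mono Finset.subset_union_right
  refine ⟨h.F_le.trans hsub, h.active.union hg hpE, Finset.inter_subset_left.trans h.A_sub,
    Finset.inter_subset_inter_right h.Aj_sub, h.A₀_sub, ?_, h.Q_sub, ?_, ?_, ?_, ?_⟩
  · rw [← h.Q_eq]
    ext v
    simp only [Config.build, Finset.mem_union, Finset.mem_inter, Finset.mem_sdiff]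
    tauto
  · intro heq
    exfalso
    change x.F ∪ p = F₀ at heq
    have : x.F ∪ p ⊆ x.F := heq ▸ h.F_le
    exact hnot (hcon.mono this)
  · rintro rfl
    exact absurd (h.A_sub (h.Aj_sub hs₁)) (Finset.notMem_empty _)
  · intro e he
    rcases Finset.mem_union.1 he with he | he
    · exact h.built_tight e he
    · rcases Finset.mem_union.1 (hp.subset he) with he' | he'
      · rcases hl.tight e he' with h' | h'
        · exact h.built_tight e h'
        · exact Or.inr ⟨he', h'⟩
      · exact h.built_tight e he'
  · obtain ⟨m, hm, hU⟩ := h.progress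
    refine ⟨m + 1, ?_, ?_⟩
    · change cost c (x.F ∪ p) ≤ _
      rw [cost_union_sdiff]
      -- The cheap target `t` need not be `s₂`; the minimal choice of `p` over all targets of `s₁`
      -- transfers its bound. Only the target has to lie in `Q'`, so the argument also covers the
      -- consolidate phase, where `Q'` is `P_j`.
      obtain ⟨t, ht, h1, h2, q, hq, hqc, hqr⟩ := hl.exists_near hc hF hs₂ hbar hnot
      obtain ⟨p', hp'q, hp'⟩ := exists_isPathSet hq hqc
      have h3 := hmin t p' ⟨hs₁, ht, h1, h2⟩ hp'
      have h4 : cost c (p' \ x.F) ≤ cost c (q \ x.F) :=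
        cost_mono (Finset.sdiff_subset_sdiff hp'q le_rfl) fun e he =>
          hl.cost_nonneg hc hF e (hq (Finset.mem_sdiff.1 he).1)
      push_cast
      linarith
    · intro U hUs
      have h1 := hU U hUs
      obtain ⟨w₁, hw₁, hc₁⟩ := hUs s₁ (h.A₀_sub (h.A_sub (h.Aj_sub hs₁)))
      obtain ⟨w₂, hw₂, hc₂⟩ := hUs s₂ (hQ' hs₂)
      have hc₁' := hc₁.mono h.F_le
      have hc₂' := hc₂.mono h.F_le
      have h2 := rank_lt hsub hw₁ hw₂ (fun h' => hnot ((hc₁'.trans h').trans hc₂'.symm))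
        (((hc₁'.mono hsub).symm.trans hcon).trans (hc₂'.mono hsub))
      change rank F₀ U + (m + 1) ≤ rank (x.F ∪ p) U
      omega

theorem RunInv.addEdge (h : RunInv G c g j F₀ A₀ Q x) (e : Sym2 V) :
    RunInv G c g j F₀ A₀ Q (x.addEdge e) :=
  ⟨h.1, h.2, h.3, h.4, h.5, h.6, h.7, h.8, h.9, fun e' he' =>
    (h.built_tight e' he').imp_right fun h' => ⟨Finset.mem_insert_of_mem h'.1, h'.2⟩, h.11⟩

/-- The invariant of the consolidate phase. -/
structure ConsInv (G : SimpleGraph V) (c : Sym2 V → ℝ) (g : Finset V → Bool) (j : ℤ)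
    (F₀ : Finset (Sym2 V)) (A₀ Q W : Finset V) (x : Config V) : Prop where
  run : RunInv G c g j F₀ A₀ Q x
  A_eq : x.Aj = x.A
  lev : LevelInv G c g j x.F x.lev x.lev.prev W

theorem ConsInv.start (hc : ∀ e ∈ edges G, 0 ≤ c e) {d : LevelData V} {F : Finset (Sym2 V)}
    (hF : F ⊆ F₀) (hd : LevelInv G c g j F d d.prev W) (hA : ActiveInv G g F₀ A₀) :
    ConsInv G c g j F₀ A₀ (A₀ ∪ d.prev) W { F := F₀, A := A₀, Aj := A₀, lev := d } where
  run :=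
    { F_le := le_rfl
      active := hA
      A_sub := le_rfl
      Aj_sub := le_rfl
      A₀_sub := Finset.subset_union_left
      Q_eq := rfl
      Q_sub := Finset.union_subset (fun _ hs => (mem_activeTerminals.1 (hA.sub hs)).1) hd.Q_sub
      A_eq := fun _ => rfl
      F_eq := fun _ => rfl
      built_tight := fun _ he => Or.inl he
      progress := ⟨0, by simp, fun _ _ => le_rfl⟩ }
  A_eq := rfl
  lev := hd.mono_F hc (hF.trans hA.F_sub) hF

theorem ConsInv.connect (h : ConsInv G c g j F₀ A₀ Q W x) (hg : IsProper g)
    (hc : ∀ e ∈ edges G, 0 ≤ c e) (hx : Connect G c g x.lev.prev x x') :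
    ConsInv G c g j F₀ A₀ Q W x' := by
  have hQ : x.lev.prev ⊆ Q := h.run.Q_eq ▸ Finset.subset_union_right
  have hrun := h.run.connect hg hc hQ h.lev hx
  obtain ⟨s₁, s₂, p, hcan, hp, hmin, rfl⟩ := hx
  refine ⟨hrun, ?_, ?_⟩
  · simp only [Config.build, h.A_eq]
  · refine ((h.lev.mono_F hc h.run.active.F_sub Finset.subset_union_left).mono_Q
      (Q' := (x.build G g p).lev.prev) Finset.subset_union_left ?_).with_prev _
    exact Finset.Subset.trans (hrun.Q_eq ▸ Finset.subset_union_right) hrun.Q_sub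

theorem ConsInv.addEdge (h : ConsInv G c g j F₀ A₀ Q W x) (hc : ∀ e ∈ edges G, 0 ≤ c e)
    {e : Sym2 V} (he : e ∈ x.F) : ConsInv G c g j F₀ A₀ Q W (x.addEdge e) :=
  ⟨h.run.addEdge e, h.A_eq,
    h.lev.addEdge hc h.run.active.F_sub (h.run.active.F_sub he) (Or.inl he)⟩

theorem ConsInv.connectLoop (hg : IsProper g) (hc : ∀ e ∈ edges G, 0 ≤ c e)
    (hx : ConnectLoop G c g x x') (h : ConsInv G c g j F₀ A₀ Q W x) :
    ConsInv G c g j F₀ A₀ Q W x' := by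
  induction hx with
  | done x _ => exact h
  | step x x' x'' hx _ ih => exact ih (h.connect hg hc hx)

theorem ConsInv.consolidateLoop (hg : IsProper g) (hc : ∀ e ∈ edges G, 0 ≤ c e)
    (hx : ConsolidateLoop G c g x x') (h : ConsInv G c g j F₀ A₀ Q W x) :
    ConsInv G c g j F₀ A₀ Q W x' ∧ x'.F ⊆ x'.lev.Fbar := by
  induction hx with
  | done x hx => exact ⟨h, hx⟩
  | step x x' x'' e he hx _ ih =>
    exact ih (ConsInv.connectLoop hg hc hx (h.addEdge hc (Finset.mem_sdiff.1 he).1))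

/-- The invariant of the dual growth phase. -/
structure GrowInv (G : SimpleGraph V) (c : Sym2 V → ℝ) (g : Finset V → Bool) (j : ℤ)
    (F₀ : Finset (Sym2 V)) (A₀ Q W : Finset V) (x : Config V) : Prop where
  run : RunInv G c g j F₀ A₀ Q x
  F_sub : x.F ⊆ x.lev.Fbar
  lev : LevelInv G c g j x.F x.lev Q W
  passed : ∀ s ∈ x.A, s ∉ x.Aj → ∃ w ∈ W, Conn x.F s w

/-- During consolidation the level invariant must refer to `P_j` alone, since purchases may only aim
at `P_j`. Afterwards the targets are `A_j ∪ P_j`, and `Q` is enlarged accordingly. No terminal has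
yet left `A_j` while staying active. -/
theorem ConsInv.growInv (h : ConsInv G c g j F₀ A₀ Q W x) (hF : x.F ⊆ x.lev.Fbar) :
    GrowInv G c g j F₀ A₀ Q W x where
  run := h.run
  F_sub := hF
  lev := h.lev.mono_Q (h.run.Q_eq ▸ Finset.subset_union_right) h.run.Q_sub
  passed _ hs hs' := absurd (h.A_eq ▸ hs) hs'

theorem GrowInv.connect (h : GrowInv G c g j F₀ A₀ Q W x) (hg : IsProper g)
    (hc : ∀ e ∈ edges G, 0 ≤ c e) (hx : Connect G c g (x.Aj ∪ x.lev.prev) x x') :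
    GrowInv G c g j F₀ A₀ Q W x' := by
  rw [h.run.Q_eq] at hx
  have hrun := h.run.connect hg hc le_rfl h.lev hx
  obtain ⟨s₁, s₂, p, hcan, hp, hmin, rfl⟩ := hx
  have hsub : x.F ⊆ x.F ∪ p := Finset.subset_union_left
  refine ⟨hrun, ?_, (h.lev.mono_F hc h.run.active.F_sub hsub).with_prev _, ?_⟩
  · exact Finset.union_subset h.F_sub (hp.subset.trans (Finset.union_subset le_rfl h.F_sub))
  · intro s hs hs'
    obtain ⟨hs1, hs2⟩ := Finset.mem_inter.1 hs
    obtain ⟨w, hw, hsw⟩ := h.passed s hs1 fun hj => hs' (Finset.mem_inter.2 ⟨hj, hs2⟩)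
    exact ⟨w, hw, hsw.mono hsub⟩

theorem GrowInv.addEdge (h : GrowInv G c g j F₀ A₀ Q W x) (hc : ∀ e ∈ edges G, 0 ≤ c e)
    {e : Sym2 V} (he : TightEvent G c x e) : GrowInv G c g j F₀ A₀ Q W (x.addEdge e) :=
  ⟨h.run.addEdge e, h.F_sub.trans (Finset.subset_insert _ _),
    h.lev.addEdge hc h.run.active.F_sub he.1 (Or.inr he.2.2), h.passed⟩

/-- As `F ⊆ F̄`, a required moat is a union of components of `F`. One of them is violated and hence
holds an active terminal. -/
theorem GrowInv.meets (h : GrowInv G c g j F₀ A₀ Q W x) (hg : IsProper g) {S : Finset V}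
    (hS : x.lev.IsActiveMoat g j S) : ∃ t ∈ Q, t ∈ S := by
  obtain ⟨⟨v, rfl⟩, hgS, _⟩ := hS
  obtain ⟨u, hu, hgu⟩ := hg.exists_comp x.F (S := comp x.lev.Fbar v) (fun a ha b hab =>
    mem_comp.2 ((mem_comp.1 ha).trans (hab.mono h.F_sub))) hgS
  obtain ⟨a, ha, hua⟩ := h.run.active.cover u hgu
  exact ⟨a, h.run.A₀_sub (h.run.A_sub ha),
    mem_comp.2 ((mem_comp.1 hu).trans (hua.mono h.F_sub))⟩

theorem Config.notMem_limited_zero {s : V} (hs : s ∈ terminals g) : s ∉ x.limited g j 0 := by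
  intro h
  obtain ⟨_, hact, hload⟩ := Finset.mem_filter.1 h
  rw [LevelData.load_raise, if_pos hact, add_zero] at hload
  exact hact.2.2 ⟨s, mem_comp.2 (Conn.refl _ s), hs, hload⟩

theorem Config.Q_grow (g : Finset V → Bool) (j : ℤ) (x : Config V) (ε : ℝ) :
    (x.grow g j ε).Aj ∪ (x.grow g j ε).lev.prev = x.Aj ∪ x.lev.prev := by
  have : x.limited g j ε ⊆ x.Aj := Finset.filter_subset _ _
  ext v
  have := @this v
  simp only [Config.grow, Finset.mem_union, Finset.mem_sdiff]
  tauto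

/-- If no event has occurred, then in each moat all of `Q` is connected to `A_j`. -/
theorem GrowInv.conn_of_not_event (h : GrowInv G c g j F₀ A₀ Q W x)
    (hev : ¬ Event G c g j x 0) {s t : V} (hs : s ∈ x.Aj) (ht : t ∈ Q)
    (hst : Conn x.lev.Fbar s t) : Conn x.F s t := by
  by_contra hnot
  refine hev (Or.inr (Or.inr ⟨s, t, ?_, ?_, hst, hnot⟩))
  · refine Finset.mem_sdiff.2 ⟨hs, Config.notMem_limited_zero ?_⟩
    exact h.run.Q_sub (h.run.A₀_sub (h.run.A_sub (h.run.Aj_sub hs)))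
  · rwa [Config.Q_grow, h.run.Q_eq]

/-- Growth stops at the first event, so no constraint is overshot. A terminal that reaches its limit
gets an element of `W'` in its moat, and the absence of a pending connection makes the two connected
in `F`. -/
theorem GrowInv.grow (h : GrowInv G c g j F₀ A₀ Q W x) (hg : IsProper g) {ε : ℝ} (hε : 0 ≤ ε)
    (hev : ∀ ε' : ℝ, 0 ≤ ε' → ε' < ε → ¬ Event G c g j x ε') :
    ∃ W', W ⊆ W' ∧ GrowInv G c g j F₀ A₀ Q W' (x.grow g j ε) := by
  have hcut : ∀ e ∈ edges G, (x.lev.raise g j ε).cut G e ≤ c e := by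
    intro e he
    by_cases hF : e ∈ x.lev.Fbar
    · rw [LevelData.cut_raise_of_mem G g j _ ε hF]
      exact h.lev.cut_le e he
    have h0 := h.lev.cut_le e he
    by_contra hcon
    rw [LevelData.cut_raise] at hcon
    set n := ((Finset.univ.filter (fun S : Finset V =>
      e ∈ delta G S)).filter (fun S => x.lev.IsActiveMoat g j S)).card with hn
    push Not at hcon
    have hn0 : (0 : ℝ) < n := by
      rcases Nat.eq_zero_or_pos n with h' | h'
      · rw [h'] at hcon
        simp only [Nat.cast_zero, zero_mul, add_zero] at hcon
        linarith
      · exact_mod_cast h'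
    -- With `n` active moats crossing `e`, this is the moment at which `e` becomes tight; it
    -- precedes `ε`.
    refine hev ((c e - x.lev.cut G e) / n) (div_nonneg (by linarith) hn0.le) ?_
      (Or.inr (Or.inl ⟨e, he, hF, ?_⟩))
    · rw [div_lt_iff₀ hn0]
      linarith
    · change (x.lev.raise g j _).cut G e = c e
      rw [LevelData.cut_raise, ← hn]
      field_simp
      ring
  have hlim : ∀ s ∈ Q, (x.lev.raise g j ε).load s ≤ (2 : ℝ) ^ j := by
    intro s hs
    have h0 := h.lev.load_le s
    rw [LevelData.load_raise]
    split_ifs with hact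
    · by_contra hcon
      push Not at hcon
      refine hev (2 ^ j - x.lev.load s) (by linarith) (by linarith)
        (Or.inl ⟨_, hact, s, mem_comp.2 (Conn.refl _ s), h.run.Q_sub hs, ?_⟩)
      change (x.lev.raise g j _).load s = _
      rw [LevelData.load_raise, if_pos hact]
      ring
    · linarith
  obtain ⟨W', hW, hl⟩ := h.lev.raise hε (fun S hS => h.meets hg hS) hcut hlim
  refine ⟨W', hW, ⟨h.run.F_le, h.run.active, h.run.A_sub,
    Finset.sdiff_subset.trans h.run.Aj_sub, h.run.A₀_sub, ?_, h.run.Q_sub, h.run.A_eq,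
    h.run.F_eq, ?_, h.run.progress⟩, h.F_sub, hl.with_prev _, ?_⟩
  · rw [Config.Q_grow, h.run.Q_eq]
  · intro e he
    refine (h.run.built_tight e he).imp_right fun h' => ⟨h'.1, ?_⟩
    change (x.lev.raise g j ε).cut G e = c e
    rw [LevelData.cut_raise_of_mem G g j _ ε h'.1]
    exact h'.2
  · intro s hs hs'
    by_cases hj : s ∈ x.Aj
    · have hlt : s ∈ x.limited g j ε := by
        by_contra hcon
        exact hs' (Finset.mem_sdiff.2 ⟨hj, hcon⟩)
      have hst : s ∈ terminals g := h.run.Q_sub (h.run.A₀_sub (h.run.A_sub hs))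
      -- Zero growth limits no terminal. So `ε > 0`, and the absence of events is available at `0`.
      have hpos : 0 < ε := by
        refine lt_of_le_of_ne hε ?_
        rintro rfl
        exact Config.notMem_limited_zero hst hlt
      obtain ⟨w, hw, hsw⟩ := hl.W_cover s (Finset.mem_filter.1 hlt).2.2
      exact ⟨w, hw, h.conn_of_not_event (hev 0 le_rfl hpos) hj (hl.W_sub hw) hsw⟩
    · obtain ⟨w, hw, hsw⟩ := h.passed s hs hj
      exact ⟨w, hW hw, hsw⟩

theorem GrowInv.growthIter (h : GrowInv G c g j F₀ A₀ Q W x) (hg : IsProper g)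
    (hc : ∀ e ∈ edges G, 0 ≤ c e) (hx : GrowthIter G c g j x x') :
    ∃ W', W ⊆ W' ∧ GrowInv G c g j F₀ A₀ Q W' x' := by
  obtain ⟨ε, hε, hev, hx⟩ := hx
  obtain ⟨W', hW, h'⟩ := h.grow hg hε hev
  refine ⟨W', hW, ?_⟩
  rcases hx with ⟨_, rfl⟩ | ⟨e, he, rfl⟩ | hx
  · exact h'
  · exact h'.addEdge hc he
  · exact h'.connect hg hc hx

/-- Let `s` remain in `A_j` when growth is stuck. Any other violated component of `F` in its moat
would contain an active terminal, hence an element of `Q` still to be connected to `s`. So the moat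
is required by `IsProper.eq_true_of_sdiff`. Not being active, it is at its limit and contains an
element of `W`, which is connected to `s` because no event is pending. -/
theorem GrowInv.conn_of_done (h : GrowInv G c g j F₀ A₀ Q W x) (hg : IsProper g)
    (hx : x.Aj = ∅ ∨ ((∀ S, ¬ x.lev.IsActiveMoat g j S) ∧ ¬ Event G c g j x 0)) :
    ∀ s ∈ x.A, ∃ w ∈ W, Conn x.F s w := by
  intro s hs
  by_cases hj : s ∈ x.Aj
  swap
  · exact h.passed s hs hj
  rcases hx with hx | ⟨hact, hev⟩
  · rw [hx] at hj
    exact absurd hj (Finset.notMem_empty _)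
  have hsub : comp x.F s ⊆ comp x.lev.Fbar s := fun v hv =>
    mem_comp.2 ((mem_comp.1 hv).mono h.F_sub)
  have hgM : g (comp x.lev.Fbar s) = true := by
    refine hg.eq_true_of_sdiff hsub (mem_activeTerminals.1 (h.run.active.sub hs)).2 ?_
    intro hd
    obtain ⟨v, hv, hgv⟩ := hg.exists_comp x.F (fun a ha b hab => by
      rw [Finset.mem_sdiff, mem_comp, mem_comp] at ha ⊢
      exact ⟨ha.1.trans (hab.mono h.F_sub), fun h' => ha.2 (h'.trans hab.symm)⟩) hd
    rw [Finset.mem_sdiff, mem_comp, mem_comp] at hv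
    obtain ⟨a, ha, hva⟩ := h.run.active.cover v hgv
    have := h.conn_of_not_event hev hj (h.run.A₀_sub (h.run.A_sub ha))
      (hv.1.trans (hva.mono h.F_sub))
    exact hv.2 (this.trans hva.symm)
  have hlim : x.lev.AtLimit g j (comp x.lev.Fbar s) := by
    by_contra hcon
    exact hact _ ⟨⟨s, rfl⟩, hgM, hcon⟩
  obtain ⟨v, hv, _, hvl⟩ := hlim
  obtain ⟨w, hw, hvw⟩ := h.lev.W_cover v hvl
  exact ⟨w, hw, h.conn_of_not_event hev hj (h.lev.W_sub hw) ((mem_comp.1 hv).trans hvw)⟩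

theorem GrowInv.growthLoop (hg : IsProper g) (hc : ∀ e ∈ edges G, 0 ≤ c e)
    (hx : GrowthLoop G c g j x x') (h : GrowInv G c g j F₀ A₀ Q W x) :
    ∃ W', W ⊆ W' ∧ GrowInv G c g j F₀ A₀ Q W' x' ∧ ∀ s ∈ x'.A, ∃ w ∈ W', Conn x'.F s w := by
  induction hx generalizing W with
  | done x hx => exact ⟨W, le_rfl, h, h.conn_of_done hg hx⟩
  | step x x' x'' _ hx _ ih =>
    obtain ⟨W₁, hW₁, h₁⟩ := h.growthIter hg hc hx
    obtain ⟨W₂, hW₂, h₂⟩ := ih h₁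
    exact ⟨W₂, hW₁.trans hW₂, h₂⟩

end

/-- What the work at level `j` achieves. -/
structure LevelResult (G : SimpleGraph V) (c : Sym2 V → ℝ) (g : Finset V → Bool) (j : ℤ)
    (F : Finset (Sym2 V)) (A : Finset V) (d : LevelData V) (F' : Finset (Sym2 V))
    (A' : Finset V) (d' : LevelData V) (W' : Finset V) : Prop where
  F_le : F ⊆ F'
  active : ActiveInv G g F' A'
  A_sub : A' ⊆ A
  A_eq : F' = F → A' = A
  F_eq : A = ∅ → F' = F
  prev_eq : d'.prev = A ∪ d.prev
  lev : LevelInv G c g j F' d' d'.prev W'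
  built_tight : ∀ e ∈ F', e ∈ F ∨ d'.IsTight G c e
  conn : ∀ s ∈ A', ∃ w ∈ W', Conn F' s w
  progress : ∃ m : ℕ, cost c F' ≤ cost c F + m * (2 * (2 : ℝ) ^ j) ∧
    ∀ U : Finset V, (∀ s ∈ A ∪ d.prev, ∃ w ∈ U, Conn F s w) → rank F U + m ≤ rank F' U

theorem LevelRun.result {G : SimpleGraph V} {c : Sym2 V → ℝ} {g : Finset V → Bool} {j : ℤ}
    (hg : IsProper g) (hc : ∀ e ∈ edges G, 0 ≤ c e) {F₀ F F' : Finset (Sym2 V)}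
    {A A' W : Finset V} {d d' : LevelData V} (hF : F₀ ⊆ F)
    (hd : LevelInv G c g j F₀ d d.prev W) (hA : ActiveInv G g F A)
    (h : LevelRun G c g j F A d F' A' d') :
    ∃ W', W ⊆ W' ∧ LevelResult G c g j F A d F' A' d' W' := by
  obtain ⟨x, x', h1, h2, rfl, rfl, rfl⟩ := h
  obtain ⟨hx, hxF⟩ := ConsInv.consolidateLoop hg hc h1 (ConsInv.start hc hF hd hA)
  obtain ⟨W', hW, hx', hconn⟩ := GrowInv.growthLoop hg hc h2 (hx.growInv hxF)
  have hQ : x'.lev.prev ∪ x'.Aj = A ∪ d.prev := by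
    rw [Finset.union_comm, hx'.run.Q_eq]
  refine ⟨W', hW, hx'.run.F_le, hx'.run.active, hx'.run.A_sub, hx'.run.A_eq, hx'.run.F_eq, hQ,
    ?_, fun e he => (hx'.run.built_tight e he).imp_right fun h => h.2, hconn, hx'.run.progress⟩
  have := hx'.lev.with_prev (x'.lev.prev ∪ x'.Aj)
  rw [← hQ] at this
  exact this

/-! ### The work at one level can be carried out -/

section

variable {G : SimpleGraph V} {c : Sym2 V → ℝ} {g : Finset V → Bool} {j : ℤ}
  {F₀ : Finset (Sym2 V)} {A₀ Q W : Finset V} {x x' : Config V}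

theorem card_sdiff_lt {E F F' : Finset (Sym2 V)} (h : F ⊂ F') (hE : F' ⊆ E) :
    (E \ F').card < (E \ F).card := by
  refine Finset.card_lt_card ⟨Finset.sdiff_subset_sdiff le_rfl h.1, fun hh => h.2 fun e he => ?_⟩
  by_contra hF
  exact (Finset.mem_sdiff.1 (hh (Finset.mem_sdiff.2 ⟨hE he, hF⟩))).2 he

theorem exists_connect {Q' : Finset V} {s₁ s₂ : V} (h : x.CanConnect Q' s₁ s₂) :
    ∃ x', Connect G c g Q' x x' := by
  obtain ⟨q, _, hq⟩ := exists_isPathSet (H := x.lev.Fbar ∪ x.F) Finset.subset_union_left h.2.2.1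
  obtain ⟨p, hp, hmin⟩ := Finset.exists_min_image
    (Finset.univ.filter (fun p : Finset (Sym2 V) =>
      ∃ t, x.CanConnect Q' s₁ t ∧ IsPathSet (x.lev.Fbar ∪ x.F) s₁ t p))
    (fun p => cost c (p \ x.F)) ⟨q, Finset.mem_filter.2 ⟨Finset.mem_univ _, s₂, h, hq⟩⟩
  obtain ⟨t, ht, hpt⟩ := (Finset.mem_filter.1 hp).2
  exact ⟨_, s₁, t, p, ht, hpt, fun t' q' ht' hq' =>
    hmin q' (Finset.mem_filter.2 ⟨Finset.mem_univ _, t', ht', hq'⟩), rfl⟩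

theorem Connect.ssubset {Q' : Finset V} (h : Connect G c g Q' x x') : x.F ⊂ x'.F := by
  obtain ⟨s₁, s₂, p, hcan, hp, _, rfl⟩ := h
  refine ⟨Finset.subset_union_left, fun hh => hcan.2.2.2 ?_⟩
  exact hp.conn.mono (Finset.subset_union_right.trans hh)

theorem Connect.Fbar_eq {Q' : Finset V} (h : Connect G c g Q' x x') :
    x'.lev.Fbar = x.lev.Fbar := by
  obtain ⟨s₁, s₂, p, _, _, _, rfl⟩ := h
  rfl

theorem Connect.y_eq {Q' : Finset V} (h : Connect G c g Q' x x') : x'.lev.y = x.lev.y := by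
  obtain ⟨s₁, s₂, p, _, _, _, rfl⟩ := h
  rfl

theorem ConsInv.exists_connectLoop (h : ConsInv G c g j F₀ A₀ Q W x) (hg : IsProper g)
    (hc : ∀ e ∈ edges G, 0 ≤ c e) :
    ∃ x', ConnectLoop G c g x x' ∧ x'.lev.Fbar = x.lev.Fbar := by
  induction hn : (edges G \ x.F).card using Nat.strong_induction_on generalizing x with
  | _ n ih =>
    by_cases hdone : ∀ s₁ s₂, ¬ x.CanConnect x.lev.prev s₁ s₂
    · exact ⟨x, .done x hdone, rfl⟩
    · push Not at hdone
      obtain ⟨s₁, s₂, hcan⟩ := hdone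
      obtain ⟨x₁, hx₁⟩ := exists_connect (G := G) (c := c) (g := g) hcan
      have h₁ := h.connect hg hc hx₁
      obtain ⟨x₂, hx₂, heq⟩ := ih _ (hn ▸ card_sdiff_lt hx₁.ssubset h₁.run.active.F_sub) h₁ rfl
      exact ⟨x₂, .step x x₁ x₂ hx₁ hx₂, heq.trans hx₁.Fbar_eq⟩

theorem ConsInv.exists_consolidateLoop (h : ConsInv G c g j F₀ A₀ Q W x) (hg : IsProper g)
    (hc : ∀ e ∈ edges G, 0 ≤ c e) : ∃ x', ConsolidateLoop G c g x x' := by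
  induction hn : (edges G \ x.lev.Fbar).card using Nat.strong_induction_on generalizing x with
  | _ n ih =>
    by_cases hdone : x.F ⊆ x.lev.Fbar
    · exact ⟨x, .done x hdone⟩
    · obtain ⟨e, he, heF⟩ := Finset.not_subset.1 hdone
      have h₁ := h.addEdge hc he
      obtain ⟨x₁, hx₁, heq⟩ := h₁.exists_connectLoop hg hc
      have h₂ := ConsInv.connectLoop hg hc hx₁ h₁
      have hlt : (edges G \ x₁.lev.Fbar).card < n := by
        rw [← hn]
        refine card_sdiff_lt ?_ h₂.lev.Fbar_sub
        rw [heq]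
        exact Finset.ssubset_insert heF
      obtain ⟨x₂, hx₂⟩ := ih _ hlt h₂ rfl
      exact ⟨x₂, .step x x₁ x₂ e (Finset.mem_sdiff.2 ⟨he, heF⟩) hx₁ hx₂⟩

/-- Limits and tightness are linear equations in `ε`, with one candidate time per terminal and per
edge. An edge crossed by no active moat could only be tight from the outset. Event (3) cannot arise
by growth, which changes neither `F`, nor `F̄`, nor `Q`, and can only shrink `A_j`. -/
theorem GrowInv.finite_event (h : GrowInv G c g j F₀ A₀ Q W x) (hev : ¬ Event G c g j x 0) :
    {ε : ℝ | 0 ≤ ε ∧ Event G c g j x ε}.Finite := by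
  let n : Sym2 V → ℝ := fun e => ((Finset.univ.filter (fun S : Finset V =>
      e ∈ delta G S)).filter (fun S => x.lev.IsActiveMoat g j S)).card
  refine ((((terminals g).image fun s => (2 : ℝ) ^ j - x.lev.load s) ∪
    ((edges G).image fun e => (c e - x.lev.cut G e) / n e)).finite_toSet).subset ?_
  rintro ε ⟨_, hε⟩
  rw [Finset.mem_coe, Finset.mem_union, Finset.mem_image, Finset.mem_image]
  rcases hε with ⟨S, hS, s, hsS, hst, hsl⟩ | ⟨e, he, heF, het⟩ | ⟨s, t, hs, ht, hst, hnot⟩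
  · refine Or.inl ⟨s, hst, ?_⟩
    have hl : (x.lev.raise g j ε).load s = (2 : ℝ) ^ j := hsl
    rw [LevelData.load_raise, ← hS.eq_comp hsS, if_pos hS] at hl
    linarith
  · refine Or.inr ⟨e, he, ?_⟩
    have hl : (x.lev.raise g j ε).cut G e = c e := het
    rw [LevelData.cut_raise] at hl
    change x.lev.cut G e + n e * ε = c e at hl
    have hn : n e ≠ 0 := by
      intro hn
      rw [hn, zero_mul, add_zero] at hl
      refine hev (Or.inr (Or.inl ⟨e, he, heF, ?_⟩))
      change (x.lev.raise g j 0).cut G e = c e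
      rw [LevelData.cut_raise, mul_zero, add_zero, hl]
    rw [div_eq_iff hn]
    linarith
  · exfalso
    rw [Config.Q_grow, h.run.Q_eq] at ht
    exact hnot (h.conn_of_not_event hev (Finset.mem_sdiff.1 hs).1 ht hst)

theorem GrowInv.exists_growthIter (h : GrowInv G c g j F₀ A₀ Q W x) (hg : IsProper g)
    (hx : (∃ S, x.lev.IsActiveMoat g j S) ∨ Event G c g j x 0) :
    ∃ x', GrowthIter G c g j x x' := by
  have first : ∃ ε : ℝ, 0 ≤ ε ∧ (∀ ε' : ℝ, 0 ≤ ε' → ε' < ε → ¬ Event G c g j x ε') ∧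
      Event G c g j x ε := by
    by_cases hev : Event G c g j x 0
    · exact ⟨0, le_rfl, fun ε' h1 h2 => absurd h1 (not_le.2 h2), hev⟩
    obtain ⟨S, hS⟩ := hx.resolve_right hev
    obtain ⟨s, hsS, hst⟩ := hg.exists_terminal hS.2.1
    -- An active moat contains a terminal, and the slack of that terminal is the time of a limit
    -- event.
    have hne : {ε : ℝ | 0 ≤ ε ∧ Event G c g j x ε}.Nonempty := by
      refine ⟨2 ^ j - x.lev.load s, sub_nonneg.2 (h.lev.load_le s),
        Or.inl ⟨S, hS, s, hsS, hst, ?_⟩⟩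
      change (x.lev.raise g j _).load s = _
      rw [LevelData.load_raise, ← hS.eq_comp hsS, if_pos hS]
      ring
    obtain ⟨ε, hε, hmin⟩ := Set.exists_min_image _ id (h.finite_event hev) hne
    exact ⟨ε, hε.1, fun ε' h1 h2 h3 => absurd (hmin ε' ⟨h1, h3⟩) (not_le.2 h2), hε.2⟩
  obtain ⟨ε, hε, hmin, hev⟩ := first
  rcases hev with hl | ⟨e, he⟩ | ⟨s, t, hst⟩
  · exact ⟨_, ε, hε, hmin, Or.inl ⟨hl, rfl⟩⟩
  · exact ⟨_, ε, hε, hmin, Or.inr (Or.inl ⟨e, he, rfl⟩)⟩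
  · obtain ⟨x', hx'⟩ := exists_connect (G := G) (c := c) (g := g) hst
    exact ⟨x', ε, hε, hmin, Or.inr (Or.inr hx')⟩

/-- A quantity that decreases in every iteration of the dual growth loop. -/
def growthMeasure (G : SimpleGraph V) (g : Finset V → Bool) (j : ℤ) (x : Config V) : ℕ :=
  (edges G \ x.F).card + (edges G \ x.lev.Fbar).card +
    ((terminals g).filter (fun v => x.lev.load v ≠ (2 : ℝ) ^ j)).card

theorem filter_load_grow_subset (g : Finset V → Bool) (j : ℤ) (x : Config V) (ε : ℝ) :
    (terminals g).filter (fun v => (x.grow g j ε).lev.load v ≠ (2 : ℝ) ^ j) ⊆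
      (terminals g).filter (fun v => x.lev.load v ≠ (2 : ℝ) ^ j) := by
  intro v hv
  rw [Finset.mem_filter] at hv ⊢
  refine ⟨hv.1, fun hl => hv.2 ?_⟩
  change (x.lev.raise g j ε).load v = _
  rw [LevelData.load_raise, if_neg, add_zero, hl]
  exact fun hact => hact.2.2 ⟨v, mem_comp.2 (Conn.refl _ v), hv.1, hl⟩

/-- Event (1) fills a terminal, event (2) enlarges `F̄`, event (3) enlarges `F`; full terminals stay
full because their moats are not active. -/
theorem GrowInv.growthMeasure_lt (h : GrowInv G c g j F₀ A₀ Q W x) (hg : IsProper g)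
    (hc : ∀ e ∈ edges G, 0 ≤ c e) (hx : GrowthIter G c g j x x') :
    growthMeasure G g j x' < growthMeasure G g j x := by
  obtain ⟨_, _, h'⟩ := h.growthIter hg hc hx
  obtain ⟨ε, hε, hev, hx⟩ := hx
  have hsub := filter_load_grow_subset g j x ε
  unfold growthMeasure
  rcases hx with ⟨⟨S, hS, s, hsS, hst, hsl⟩, rfl⟩ | ⟨e, he, rfl⟩ | hx
  · refine Nat.add_lt_add_left (Finset.card_lt_card ⟨hsub, fun hh => ?_⟩) _
    have : s ∈ (terminals g).filter (fun v => x.lev.load v ≠ (2 : ℝ) ^ j) :=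
      Finset.mem_filter.2 ⟨hst, fun hl => hS.2.2 ⟨s, hsS, hst, hl⟩⟩
    exact (Finset.mem_filter.1 (hh this)).2 hsl
  · have h1 : (edges G \ ((x.grow g j ε).addEdge e).lev.Fbar).card <
        (edges G \ x.lev.Fbar).card :=
      card_sdiff_lt (Finset.ssubset_insert he.2.1) h'.lev.Fbar_sub
    exact add_lt_add_of_lt_of_le (Nat.add_lt_add_left h1 _) (Finset.card_le_card hsub)
  · have h1 : (edges G \ x'.F).card < (edges G \ x.F).card :=
      card_sdiff_lt hx.ssubset h'.run.active.F_sub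
    have h2 : x'.lev.Fbar = x.lev.Fbar := hx.Fbar_eq
    have h3 : ∀ v, x'.lev.load v = (x.grow g j ε).lev.load v := fun v => by
      unfold LevelData.load
      rw [hx.y_eq]
    simp only [h2, h3]
    exact add_lt_add_of_lt_of_le (Nat.add_lt_add_right h1 _) (Finset.card_le_card hsub)

theorem GrowInv.exists_growthLoop (h : GrowInv G c g j F₀ A₀ Q W x) (hg : IsProper g)
    (hc : ∀ e ∈ edges G, 0 ≤ c e) : ∃ x', GrowthLoop G c g j x x' := by
  induction hn : growthMeasure G g j x using Nat.strong_induction_on generalizing x W with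
  | _ n ih =>
    by_cases hdone : x.Aj = ∅ ∨ ((∀ S, ¬ x.lev.IsActiveMoat g j S) ∧ ¬ Event G c g j x 0)
    · exact ⟨x, .done x hdone⟩
    · push Not at hdone
      obtain ⟨x₁, hx₁⟩ := h.exists_growthIter hg (by
        by_cases hact : ∀ S, ¬ x.lev.IsActiveMoat g j S
        · exact Or.inr (hdone.2 hact)
        · push Not at hact
          exact Or.inl hact)
      obtain ⟨W₁, _, h₁⟩ := h.growthIter hg hc hx₁
      obtain ⟨x₂, hx₂⟩ := ih _ (hn ▸ h.growthMeasure_lt hg hc hx₁) h₁ rfl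
      exact ⟨x₂, .step x x₁ x₂ hdone.1 hx₁ hx₂⟩

end

theorem exists_levelRun {G : SimpleGraph V} {c : Sym2 V → ℝ} {g : Finset V → Bool} {j : ℤ}
    (hg : IsProper g) (hc : ∀ e ∈ edges G, 0 ≤ c e) {F₀ F : Finset (Sym2 V)} {A W : Finset V}
    {d : LevelData V} (hF : F₀ ⊆ F) (hd : LevelInv G c g j F₀ d d.prev W)
    (hA : ActiveInv G g F A) : ∃ F' A' d', LevelRun G c g j F A d F' A' d' := by
  have h := ConsInv.start hc hF hd hA
  obtain ⟨x, hx⟩ := h.exists_consolidateLoop hg hc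
  obtain ⟨h₁, hF₁⟩ := ConsInv.consolidateLoop hg hc hx h
  obtain ⟨x', hx'⟩ := (h₁.growInv hF₁).exists_growthLoop hg hc
  exact ⟨_, _, _, x, x', hx, hx', rfl, rfl, rfl⟩

/-! ### One time step -/

/-- This geometric sum, an equality for `j > K`, spreads the price of a purchase at level `j` over
the levels between `K` and `j`, with the remainder charged to all terminals. -/
theorem zpow_le_add_sum_Ioo (K j : ℤ) :
    (2 : ℝ) ^ j ≤ 2 ^ (K + 1) + ∑ k ∈ Finset.Ioo K j, (2 : ℝ) ^ k := by
  rcases le_total j (K + 1) with hj | hj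
  · have h1 : (2 : ℝ) ^ j ≤ 2 ^ (K + 1) := zpow_le_zpow_right₀ (by norm_num) hj
    have h2 : 0 ≤ ∑ k ∈ Finset.Ioo K j, (2 : ℝ) ^ k := Finset.sum_nonneg fun k _ => by positivity
    linarith
  · induction j, hj using Int.leInduction with
    | base =>
      have h2 : 0 ≤ ∑ k ∈ Finset.Ioo K (K + 1), (2 : ℝ) ^ k :=
        Finset.sum_nonneg fun k _ => by positivity
      linarith
    | succ j hj ih =>
      have h1 : Finset.Ioo K (j + 1) = insert j (Finset.Ioo K j) := by
        ext k
        simp only [Finset.mem_Ioo, Finset.mem_insert]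
        omega
      rw [h1, Finset.sum_insert (by simp), zpow_add_one₀ (by norm_num)]
      linarith

/-- The bound on the cost of `F` in terms of the components it has merged. -/
def potential (F : Finset (Sym2 V)) (R : Finset V) (W : ℤ → Finset V) (K T : ℤ) : ℝ :=
  2 * (2 ^ (K + 1) * rank F R + ∑ k ∈ Finset.Ioc K T, (2 : ℝ) ^ k * rank F (W k))

theorem potential_mono {F F' : Finset (Sym2 V)} {R R' : Finset V} {W W' : ℤ → Finset V}
    (hF : F ⊆ F') (hR : R ⊆ R') (hW : ∀ k, W k ⊆ W' k) (K T : ℤ) :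
    potential F R W K T ≤ potential F' R' W' K T := by
  have h : ∀ {U U' : Finset V}, U ⊆ U' → (rank F U : ℝ) ≤ rank F' U' := fun {U U'} hU => by
    exact_mod_cast (rank_mono_left hF U).trans (rank_mono_right F' hU)
  unfold potential
  refine mul_le_mul_of_nonneg_left (add_le_add ?_ (Finset.sum_le_sum fun k _ => ?_)) (by norm_num)
  · exact mul_le_mul_of_nonneg_left (h hR) (by positivity)
  · exact mul_le_mul_of_nonneg_left (h (hW k)) (by positivity)

theorem potential_add_le {F F' : Finset (Sym2 V)} {R : Finset V} {W : ℤ → Finset V} {K T j : ℤ}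
    {m : ℕ} (hF : F ⊆ F') (hT : ∀ k, T < k → W k = ∅) (hR : rank F R + m ≤ rank F' R)
    (hW : ∀ k, k < j → rank F (W k) + m ≤ rank F' (W k)) :
    potential F R W K T + m * (2 * (2 : ℝ) ^ j) ≤ potential F' R W K T := by
  rcases Nat.eq_zero_or_pos m with rfl | hm
  · simpa using potential_mono hF le_rfl (fun k => le_rfl) K T
  -- Otherwise `W (T + 1)`, which is empty, would have to gain rank. Hence every level `k` with `K <
  -- k < j` occurs in the sum up to `T`.
  have hjT : j ≤ T + 1 := by
    by_contra hcon
    have h1 := hW (T + 1) (by omega)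
    rw [hT (T + 1) (by omega)] at h1
    have h2 := rank_le_card F' (∅ : Finset V)
    simp only [Finset.card_empty] at h2
    omega
  have h1 : (rank F R : ℝ) + m ≤ rank F' R := by exact_mod_cast hR
  have h2 : ∑ k ∈ Finset.Ioc K T, (2 : ℝ) ^ k * rank F (W k) +
      ∑ k ∈ Finset.Ioc K T, (if k < j then (2 : ℝ) ^ k * m else 0) ≤
      ∑ k ∈ Finset.Ioc K T, (2 : ℝ) ^ k * rank F' (W k) := by
    rw [← Finset.sum_add_distrib]
    refine Finset.sum_le_sum fun k _ => ?_
    split_ifs with hk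
    · rw [← mul_add]
      refine mul_le_mul_of_nonneg_left ?_ (by positivity)
      exact_mod_cast hW k hk
    · rw [add_zero]
      refine mul_le_mul_of_nonneg_left ?_ (by positivity)
      exact_mod_cast rank_mono_left hF (W k)
  have h3 : ∑ k ∈ Finset.Ioc K T, (if k < j then (2 : ℝ) ^ k * m else 0) =
      (∑ k ∈ Finset.Ioo K j, (2 : ℝ) ^ k) * m := by
    rw [← Finset.sum_filter, Finset.sum_mul]
    refine Finset.sum_congr ?_ fun _ _ => rfl
    ext k
    simp only [Finset.mem_filter, Finset.mem_Ioc, Finset.mem_Ioo]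
    omega
  have h4 := mul_le_mul_of_nonneg_right (zpow_le_add_sum_Ioo K j) (Nat.cast_nonneg (α := ℝ) m)
  have h5 := mul_le_mul_of_nonneg_left h1 (show (0 : ℝ) ≤ 2 ^ (K + 1) by positivity)
  unfold potential
  rw [h3] at h2
  linarith

/-- The facts that hold between two time steps. -/
structure StateInv (G : SimpleGraph V) (c : Sym2 V → ℝ) (g : Finset V → Bool) (σ : State V)
    (W : ℤ → Finset V) : Prop where
  F_sub : σ.F ⊆ edges G
  lev : ∀ j, LevelInv G c g j σ.F (σ.lev j) (σ.lev j).prev (W j)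
  conn : ∀ j, ∀ s ∈ (σ.lev j).prev, ∀ k, k < j → ∃ w ∈ W k, Conn σ.F s w
  -- Both cut-offs stay free: they are fixed only at the end, from the current optimum and number of
  -- terminals, which change from step to step.
  cost_le : ∀ K T : ℤ, (∀ k, T < k → W k = ∅) →
    cost c σ.F ≤ potential σ.F (terminals g) W K T

theorem stateInv_init {G : SimpleGraph V} {c : Sym2 V → ℝ} (hc : ∀ e ∈ edges G, 0 ≤ c e)
    (g : Finset V → Bool) : StateInv G c g State.init (fun _ => ∅) where
  F_sub := by simp [State.init]
  lev _ := LevelInv.init hc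
  conn := by simp [State.init]
  cost_le K T _ := by
    simp only [State.init, cost, Finset.sum_empty, potential]
    positivity

theorem StateInv.timeStep {G : SimpleGraph V} {c : Sym2 V → ℝ} {g₀ g : Finset V → Bool}
    {σ σ' : State V} {W : ℤ → Finset V} (h : StateInv G c g₀ σ W)
    (hc : ∀ e ∈ edges G, 0 ≤ c e) (hg : IsProper g) (hg₀ : ∀ S, g₀ S = true → g S = true)
    (hσ : TimeStep G c g σ σ') :
    σ.F ⊆ σ'.F ∧ Feasible G g σ'.F ∧ ∃ W', StateInv G c g σ' W' := by
  obtain ⟨Fs, As, Z, hZ, hZc, hbot, hrun, htop⟩ := hσ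
  obtain ⟨J, hJ⟩ := eventually_atBot.1 hbot
  obtain ⟨N, hN⟩ := eventually_atTop.1 htop
  have hlev := fun j => (h.lev j).mono_g hg₀
  have hstart : ∀ j ≤ J, σ.F ⊆ Fs j ∧ ActiveInv G g (Fs j) (As j) := by
    intro j hj
    obtain ⟨h1, h2⟩ := hJ j hj
    rw [h1, h2]
    exact ⟨Finset.subset_union_left,
      activeInv_activeTerminals hg (Finset.union_subset h.F_sub hZ)⟩
  have hinv : ∀ j, σ.F ⊆ Fs j ∧ ActiveInv G g (Fs j) (As j) := by
    intro j
    rcases le_total j J with hj | hj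
    · exact hstart j hj
    · induction j, hj using Int.leInduction with
      | base => exact hstart J le_rfl
      | succ j hj ih =>
        obtain ⟨W', _, hR⟩ := LevelRun.result hg hc ih.1 (hlev j) ih.2 (hrun j)
        exact ⟨ih.1.trans hR.F_le, hR.active⟩
  choose W' hW hR using fun j =>
    LevelRun.result hg hc (hinv j).1 (hlev j) (hinv j).2 (hrun j)
  have hFs : Monotone Fs := monotone_int_of_le_succ fun j => (hR j).F_le
  have hAs : Antitone As := antitone_int_of_succ_le fun j => (hR j).A_sub
  have hle : ∀ j, Fs j ⊆ σ'.F := fun j => by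
    rw [← (hN (max j N) (le_max_right _ _)).1]
    exact hFs (le_max_left _ _)
  -- A terminal active at level `j` was still active after each level `k < j`, hence is connected to
  -- `W' k`. Terminals active there in earlier time steps inherit this from the state invariant.
  have hconn : ∀ j, ∀ s ∈ As j ∪ (σ.lev j).prev, ∀ k, k < j →
      ∃ w ∈ W' k, Conn (Fs j) s w := by
    intro j s hs k hk
    rcases Finset.mem_union.1 hs with hs | hs
    · have hk' : k + 1 ≤ j := by omega
      obtain ⟨w, hw, hsw⟩ := (hR k).conn s (hAs hk' hs)
      exact ⟨w, hw, hsw.mono (hFs hk')⟩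
    · obtain ⟨w, hw, hsw⟩ := h.conn j s hs k hk
      exact ⟨w, hW k hw, hsw.mono (hinv j).1⟩
  have hfin := (hinv N).2
  rw [(hN N le_rfl).1, (hN N le_rfl).2] at hfin
  refine ⟨(hinv N).1.trans (hle N), hfin.feasible hg, W', hfin.F_sub, ?_, ?_, ?_⟩
  · intro j
    exact (hR j).lev.mono_F hc (hinv (j + 1)).2.F_sub (hle (j + 1))
  · intro j s hs k hk
    rw [(hR j).prev_eq] at hs
    obtain ⟨w, hw, hsw⟩ := hconn j s hs k hk
    exact ⟨w, hw, hsw.mono (hle j)⟩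
  · intro K T hT
    have hbase : cost c (Fs J) ≤ potential (Fs J) (terminals g) W' K T := by
      refine le_trans ?_ (potential_mono (hinv J).1 (terminals_mono hg₀) hW K T)
      refine le_trans ?_ (h.cost_le K T fun k hk => ?_)
      · rw [(hJ J le_rfl).1, cost_union_sdiff]
        have : cost c (Z \ σ.F) = 0 :=
          Finset.sum_eq_zero fun e he => hZc e (Finset.mem_sdiff.1 he).1
        rw [this, add_zero]
      · exact Finset.subset_empty.1 (hT k hk ▸ hW k)
    have hstep : ∀ j, J ≤ j → cost c (Fs j) ≤ potential (Fs j) (terminals g) W' K T := by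
      intro j hj
      induction j, hj using Int.leInduction with
      | base => exact hbase
      | succ j hj ih =>
        obtain ⟨m, hm, hU⟩ := (hR j).progress
        refine hm.trans (le_trans (add_le_add_left ih _) ?_)
        refine potential_add_le (hR j).F_le hT (hU _ fun s hs => ⟨s, ?_, Conn.refl _ s⟩)
          fun k hk => hU _ fun s hs => hconn j s hs k hk
        have := (hR j).lev.Q_sub
        rw [(hR j).prev_eq] at this
        exact this hs
    have := hstep (max J N) (le_max_left _ _)
    rwa [(hN (max J N) (le_max_right _ _)).1] at this

theorem StateInv.exists_timeStep {G : SimpleGraph V} {c : Sym2 V → ℝ} {g₀ g : Finset V → Bool}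
    {σ : State V} {W : ℤ → Finset V} (h : StateInv G c g₀ σ W)
    (hc : ∀ e ∈ edges G, 0 ≤ c e) (hg : IsProper g) (hg₀ : ∀ S, g₀ S = true → g S = true)
    (hE : Feasible G g (edges G)) : ∃ σ', TimeStep G c g σ σ' := by
  have hlev := fun j => (h.lev j).mono_g hg₀
  let P : Type u := {p : Finset (Sym2 V) × Finset V // σ.F ⊆ p.1 ∧ ActiveInv G g p.1 p.2}
  have hex : ∀ (j : ℤ) (p : P), ∃ (p' : P) (d' : LevelData V),
      LevelRun G c g j p.1.1 p.1.2 (σ.lev j) p'.1.1 p'.1.2 d' := by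
    rintro j ⟨⟨F, A⟩, hF, hA⟩
    obtain ⟨F', A', d', hr⟩ := exists_levelRun hg hc hF (hlev j) hA
    obtain ⟨W', _, hR⟩ := LevelRun.result hg hc hF (hlev j) hA hr
    exact ⟨⟨(F', A'), hF.trans hR.F_le, hR.active⟩, d', hr⟩
  choose nxt dat hrun using hex
  have hres := fun (j : ℤ) (p : P) => LevelRun.result hg hc p.2.1 (hlev j) p.2.2 (hrun j p)
  -- All free edges are built at the start, so that nothing is left to build at low levels.
  let Z : Finset (Sym2 V) := (edges G).filter (fun e => c e = 0)
  have hZ : Z ⊆ edges G := Finset.filter_subset _ _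
  let p₀ : P := ⟨(σ.F ∪ Z, activeTerminals G g (σ.F ∪ Z)), Finset.subset_union_left,
    activeInv_activeTerminals hg (Finset.union_subset h.F_sub hZ)⟩
  -- Below `J` no edge of positive cost can be tight, since the loads of its endpoints add up to at
  -- most `2 * 2 ^ j`.
  obtain ⟨J, hJ⟩ : ∃ J : ℤ, ∀ j ≤ J, ∀ e ∈ edges G, c e ≠ 0 → 2 * (2 : ℝ) ^ j < c e := by
    refine eventually_atBot.1 ((Filter.eventually_all_finset _).2 fun e he => ?_)
    by_cases h0 : c e = 0
    · exact Eventually.of_forall fun _ h' => absurd h0 h'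
    · have hpos : 0 < c e / 2 := half_pos (lt_of_le_of_ne (hc e he) (Ne.symm h0))
      obtain ⟨n, hn⟩ := exists_pow_lt_of_lt_one hpos (show (1 / 2 : ℝ) < 1 by norm_num)
      filter_upwards [eventually_le_atBot (-(n : ℤ))] with j hj _
      have h1 : (2 : ℝ) ^ j ≤ 2 ^ (-(n : ℤ)) := zpow_le_zpow_right₀ (by norm_num) hj
      rw [zpow_neg, zpow_natCast, ← inv_pow, ← one_div] at h1
      linarith
  have hlow : ∀ j ≤ J, nxt j p₀ = p₀ := by
    intro j hj
    obtain ⟨W', _, hR⟩ := hres j p₀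
    have hF : (nxt j p₀).1.1 = p₀.1.1 := by
      refine Finset.Subset.antisymm (fun e he => ?_) hR.F_le
      rcases hR.built_tight e he with he' | ht
      · exact he'
      have heE := hR.active.F_sub he
      refine Finset.mem_union_right _ (Finset.mem_filter.2 ⟨heE, ?_⟩)
      by_contra h0
      have h1 := hJ j hj e heE h0
      have h2 : c e ≤ 2 * (2 : ℝ) ^ j := by
        rw [← LevelData.isTight_iff.1 ht]
        induction e using Sym2.ind with
        | _ a b =>
          have := LevelData.cut_le_load G hR.lev.y_nonneg a b
          linarith [hR.lev.load_le a, hR.lev.load_le b]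
      linarith
    exact Subtype.ext (Prod.ext hF (hR.A_eq hF))
  -- The iteration really starts at level `J`. In `pos`, `toNat` sends all lower levels to the
  -- starting value, a fixed point of their runs.
  let seq : ℕ → P := fun n => Nat.rec p₀ (fun n p => nxt (J + n) p) n
  let pos : ℤ → P := fun j => seq (j - J).toNat
  have hpos_low : ∀ j ≤ J, pos j = p₀ := by
    intro j hj
    have : (j - J).toNat = 0 := by omega
    change seq (j - J).toNat = seq 0
    rw [this]
  have hpos : ∀ j, pos (j + 1) = nxt j (pos j) := by
    intro j
    rcases lt_or_ge j J with hj | hj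
    · rw [hpos_low (j + 1) (by omega), hpos_low j hj.le, hlow j hj.le]
    · have h1 : (j + 1 - J).toNat = (j - J).toNat + 1 := by omega
      have h2 : J + ((j - J).toNat : ℤ) = j := by omega
      change seq (j + 1 - J).toNat = nxt j (seq (j - J).toNat)
      rw [h1]
      change nxt (J + ((j - J).toNat : ℤ)) (seq (j - J).toNat) = _
      rw [h2]
  obtain ⟨N, hN⟩ : ∃ N : ℤ, ∀ j ≥ N, cost c (edges G) < (2 : ℝ) ^ j := by
    obtain ⟨n, hn⟩ := pow_unbounded_of_one_lt (cost c (edges G)) (show (1 : ℝ) < 2 by norm_num)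
    refine ⟨n, fun j hj => lt_of_lt_of_le hn ?_⟩
    rw [← zpow_natCast]
    exact zpow_le_zpow_right₀ (by norm_num) hj
  -- A surviving active terminal would give a nonempty `W'`, so that `2 ^ j ≤ cost E` by weak
  -- duality.
  have hhigh : ∀ j ≥ N, (pos (j + 1)).1.2 = ∅ := by
    intro j hj
    obtain ⟨W', _, hR⟩ := hres j (pos j)
    rw [hpos, Finset.eq_empty_iff_forall_notMem]
    intro s hs
    obtain ⟨w, hw, _⟩ := hR.conn s hs
    have h1 := hR.lev.mul_card_le_cost hE
    have h2 : (1 : ℝ) ≤ W'.card := by exact_mod_cast Finset.card_pos.2 ⟨w, hw⟩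
    have h3 := hN j hj
    have h4 : (0 : ℝ) < 2 ^ j := by positivity
    nlinarith
  have hconst : ∀ j, N + 1 ≤ j → (pos j).1.1 = (pos (N + 1)).1.1 ∧ (pos j).1.2 = ∅ := by
    intro j hj
    induction j, hj using Int.leInduction with
    | base => exact ⟨rfl, hhigh N le_rfl⟩
    | succ j hj ih =>
      refine ⟨?_, hhigh j (by omega)⟩
      obtain ⟨W', _, hR⟩ := hres j (pos j)
      rw [hpos, hR.F_eq ih.2, ih.1]
  refine ⟨⟨(pos (N + 1)).1.1, fun j => dat j (pos j)⟩, fun j => (pos j).1.1,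
    fun j => (pos j).1.2, Z, hZ, fun e he => (Finset.mem_filter.1 he).2, ?_, ?_, ?_⟩
  · filter_upwards [eventually_le_atBot J] with j hj
    rw [hpos_low j hj]
    exact ⟨rfl, rfl⟩
  · intro j
    have := hrun j (pos j)
    rw [← hpos] at this
    exact this
  · filter_upwards [eventually_ge_atTop (N + 1)] with j hj
    exact hconst j hj

/-- The state before step `i` was produced for the previous requirement function. `g₀` stands for it
and is identically `0` before the first step. -/
theorem Reachable.stateInv {G : SimpleGraph V} {c : Sym2 V → ℝ} {f : ℕ → Finset V → Bool}
    (hc : ∀ e ∈ edges G, 0 ≤ c e) (hf : ∀ i, IsProper (f i)) {i : ℕ} {σ : State V}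
    (h : Reachable G c f i σ) : ∃ g₀ W, StateInv G c g₀ σ W ∧
      ∀ S, g₀ S = true → cumul f i S = true := by
  induction h with
  | init => exact ⟨fun _ => false, _, stateInv_init hc _, fun S hS => by simp at hS⟩
  | step i σ σ' _ h' ih =>
    obtain ⟨g₀, W, hW, hg₀⟩ := ih
    obtain ⟨_, _, W', hW'⟩ := hW.timeStep hc (isProper_cumul hf i) hg₀ h'
    exact ⟨_, W', hW', fun S hS => cumul_mono hS⟩

/-! ### The competitive ratio -/

theorem StateInv.mul_card_le_opt {G : SimpleGraph V} {c : Sym2 V → ℝ} {g : Finset V → Bool}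
    {σ : State V} {W : ℤ → Finset V} (h : StateInv G c g σ W) (hE : Feasible G g (edges G))
    (k : ℤ) : (2 : ℝ) ^ k * (W k).card ≤ opt G c g :=
  (h.lev k).mul_card_le_opt hE

theorem StateInv.eq_empty_of_opt_lt {G : SimpleGraph V} {c : Sym2 V → ℝ}
    {g : Finset V → Bool} {σ : State V} {W : ℤ → Finset V} (h : StateInv G c g σ W)
    (hE : Feasible G g (edges G)) {k : ℤ} (hk : opt G c g < (2 : ℝ) ^ k) : W k = ∅ := by
  by_contra hne
  have h1 : (1 : ℝ) ≤ (W k).card := by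
    exact_mod_cast Finset.card_pos.2 (Finset.nonempty_iff_ne_empty.2 hne)
  have h2 := h.mul_card_le_opt hE k
  have h3 : (2 : ℝ) ^ k * 1 ≤ 2 ^ k * (W k).card :=
    mul_le_mul_of_nonneg_left h1 (by positivity)
  linarith

theorem opt_nonneg {G : SimpleGraph V} {c : Sym2 V → ℝ} (hc : ∀ e ∈ edges G, 0 ≤ c e)
    (g : Finset V → Bool) : 0 ≤ opt G c g := by
  refine Real.sInf_nonneg ?_
  rintro x ⟨H, hH, rfl⟩
  exact Finset.sum_nonneg fun e he => hc e (hH.1 he)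

/-- A set with at most one element has rank `0`, so the potential vanishes. This handles the case in
which the logarithm is `0`. -/
theorem StateInv.cost_le_zero {G : SimpleGraph V} {c : Sym2 V → ℝ} {g : Finset V → Bool}
    {σ : State V} {W : ℤ → Finset V} (h : StateInv G c g σ W) (hE : Feasible G g (edges G))
    (hn : (terminals g).card ≤ 1) : cost c σ.F ≤ 0 := by
  have hWn : ∀ k, (W k).card ≤ 1 := fun k =>
    (Finset.card_le_card ((h.lev k).W_sub.trans (h.lev k).Q_sub)).trans hn
  obtain ⟨n, hN⟩ := pow_unbounded_of_one_lt (opt G c g) (show (1 : ℝ) < 2 by norm_num)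
  have := h.cost_le 0 n fun k hk => ?_
  · simpa [potential, rank_eq_zero_of_card_le_one hn,
      fun k => rank_eq_zero_of_card_le_one (F := σ.F) (hWn k)] using this
  · have h2 : (2 : ℝ) ^ (n : ℤ) ≤ 2 ^ k := zpow_le_zpow_right₀ (by norm_num) hk.le
    rw [zpow_natCast] at h2
    exact h.eq_empty_of_opt_lt hE (hN.trans_le h2)

theorem StateInv.cost_le_log {G : SimpleGraph V} {c : Sym2 V → ℝ} {g : Finset V → Bool}
    {σ : State V} {W : ℤ → Finset V} (h : StateInv G c g σ W)
    (hc : ∀ e ∈ edges G, 0 ≤ c e) (hE : Feasible G g (edges G))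
    (hn : 1 ≤ (terminals g).card) :
    cost c σ.F ≤ 2 * (Real.logb 2 (terminals g).card + 3) * opt G c g := by
  set n := (terminals g).card with hndef
  set o := opt G c g with ho
  have hn' : (1 : ℝ) ≤ n := by exact_mod_cast hn
  have hrank : (rank σ.F (terminals g) : ℝ) ≤ n := by exact_mod_cast rank_le_card _ _
  have hWo : ∀ k, (2 : ℝ) ^ k * (W k).card ≤ o := fun k => h.mul_card_le_opt hE k
  have hempty : ∀ k, o < (2 : ℝ) ^ k → W k = ∅ := fun k hk => h.eq_empty_of_opt_lt hE hk
  rcases (opt_nonneg hc g).eq_or_lt with h0 | hpos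
  · have ho0 : o = 0 := by rw [ho, ← h0]
    rw [ho0, mul_zero]
    -- If the optimum is `0`, every `W k` is empty. Taking `K = T = -N - 1` leaves only `2 * 2 ^
    -- (-N) * rank F R`, which is arbitrarily small.
    refine le_of_forall_pos_le_add fun δ hδ => ?_
    obtain ⟨N, hN⟩ := exists_pow_lt_of_lt_one (show 0 < δ / (2 * n) by positivity)
      (show (1 / 2 : ℝ) < 1 by norm_num)
    have h1 := h.cost_le (-(N : ℤ) - 1) (-(N : ℤ) - 1) fun k _ =>
      hempty k (by rw [ho0]; positivity)
    have h2 : (2 : ℝ) ^ (-(N : ℤ)) = (1 / 2) ^ N := by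
      rw [zpow_neg, zpow_natCast, ← inv_pow, one_div]
    simp only [potential, sub_add_cancel, Finset.Ioc_self, Finset.sum_empty, add_zero, h2] at h1
    rw [lt_div_iff₀ (by positivity)] at hN
    have h3 : (1 / 2 : ℝ) ^ N * rank σ.F (terminals g) ≤ (1 / 2) ^ N * n :=
      mul_le_mul_of_nonneg_left hrank (by positivity)
    linarith
  · replace hpos : 0 < o := hpos
    -- `T` is the last level with `2 ^ T ≤ OPT`, and `K` the last with `2 ^ K * n ≤ OPT`. The
    -- constant `3` is `2` from the term `2 ^ (K + 1) * n ≤ 2 * OPT` plus `1` from rounding in `T -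
    -- K ≤ logb 2 n + 1`.
    set T := ⌊Real.logb 2 o⌋ with hT
    set K := ⌊Real.logb 2 (o / n)⌋ with hK
    have hlog : Real.logb 2 (o / n) = Real.logb 2 o - Real.logb 2 n :=
      Real.logb_div hpos.ne' (by positivity)
    have hpow : ∀ k : ℤ, (2 : ℝ) ^ k = (2 : ℝ) ^ (k : ℝ) := fun k => (Real.rpow_intCast 2 k).symm
    have h1 := h.cost_le K T fun k hk => hempty k (by
      rw [hpow, ← Real.logb_lt_iff_lt_rpow (by norm_num) hpos]
      exact Int.floor_lt.1 hk)
    have hKn : (2 : ℝ) ^ K * n ≤ o := by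
      rw [← le_div_iff₀ (by positivity), hpow,
        ← Real.le_logb_iff_rpow_le (by norm_num) (by positivity)]
      exact Int.floor_le _
    have h2 : (2 : ℝ) ^ (K + 1) * rank σ.F (terminals g) ≤ 2 * o := by
      have : (2 : ℝ) ^ (K + 1) * rank σ.F (terminals g) ≤ 2 ^ (K + 1) * n :=
        mul_le_mul_of_nonneg_left hrank (by positivity)
      rw [zpow_add_one₀ (by norm_num)] at this ⊢
      linarith
    have h3 : ∑ k ∈ Finset.Ioc K T, (2 : ℝ) ^ k * rank σ.F (W k) ≤ ((T - K : ℤ) : ℝ) * o := by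
      have hKT : K ≤ T := by
        refine Int.floor_le_floor ?_
        rw [hlog]
        linarith [Real.logb_nonneg (show (1 : ℝ) < 2 by norm_num) hn']
      calc ∑ k ∈ Finset.Ioc K T, (2 : ℝ) ^ k * rank σ.F (W k) ≤ ∑ k ∈ Finset.Ioc K T, o := by
            refine Finset.sum_le_sum fun k _ => le_trans ?_ (hWo k)
            refine mul_le_mul_of_nonneg_left ?_ (by positivity)
            exact_mod_cast rank_le_card _ _
        _ = ((T - K : ℤ) : ℝ) * o := by
            rw [Finset.sum_const, Int.card_Ioc, nsmul_eq_mul]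
            congr 1
            exact_mod_cast Int.toNat_of_nonneg (sub_nonneg.2 hKT)
    have h4 : ((T - K : ℤ) : ℝ) ≤ Real.logb 2 n + 1 := by
      have h5 : (T : ℝ) ≤ Real.logb 2 o := Int.floor_le _
      have h6 : Real.logb 2 (o / n) < K + 1 := Int.lt_floor_add_one _
      rw [hlog] at h6
      push_cast
      linarith
    have h5 := mul_le_mul_of_nonneg_right h4 hpos.le
    unfold potential at h1
    linarith

theorem StateInv.competitive {G : SimpleGraph V} {c : Sym2 V → ℝ} {g : Finset V → Bool}
    {σ : State V} {W : ℤ → Finset V} (h : StateInv G c g σ W)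
    (hc : ∀ e ∈ edges G, 0 ≤ c e) (hE : Feasible G g (edges G)) :
    cost c σ.F ≤ 2 * (Real.logb 2 ((terminals g).card : ℝ) + 3) * opt G c g ∧
      cost c σ.F ≤ 8 * Real.logb 2 ((terminals g).card : ℝ) * opt G c g := by
  have ho := opt_nonneg hc g
  rcases le_or_gt (terminals g).card 1 with hn | hn
  · have h0 := h.cost_le_zero hE hn
    have hlog : Real.logb 2 ((terminals g).card : ℝ) = 0 := by
      interval_cases (terminals g).card <;> simp
    rw [hlog]
    constructor <;> linarith
  · have h1 := h.cost_le_log hc hE hn.le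
    refine ⟨h1, h1.trans (mul_le_mul_of_nonneg_right ?_ ho)⟩
    have hn' : (2 : ℝ) ≤ (terminals g).card := by exact_mod_cast hn
    -- With at least two terminals the logarithm is at least `1`, so `log + 3 ≤ 4 * log`.
    have : 1 ≤ Real.logb 2 ((terminals g).card : ℝ) := by
      rw [Real.le_logb_iff_rpow_le (by norm_num) (by linarith), Real.rpow_one]
      exact hn'
    linarith

end

end OnlineForest

theorem mainTheorem1 {V : Type*} [Fintype V] (G : SimpleGraph V) (c : Sym2 V → ℝ)
    (hc : ∀ e ∈ G.edgeSet, 0 ≤ c e)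
    (f : ℕ → Finset V → Bool) (hf : ∀ i, OnlineForest.IsProper (f i))
    (hfeas : ∀ i, OnlineForest.Feasible G (f i) (OnlineForest.edges G))
    (i : ℕ) (σ : OnlineForest.State V) (hσ : OnlineForest.Reachable G c f i σ) :
    (∃ σ' : OnlineForest.State V, OnlineForest.TimeStep G c (OnlineForest.cumul f i) σ σ') ∧
    ∀ σ' : OnlineForest.State V, OnlineForest.TimeStep G c (OnlineForest.cumul f i) σ σ' →
      σ.F ⊆ σ'.F ∧
      OnlineForest.Feasible G (OnlineForest.cumul f i) σ'.F ∧
      OnlineForest.cost c σ'.F ≤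
        2 * (Real.logb 2 ((OnlineForest.terminals (OnlineForest.cumul f i)).card : ℝ) + 3) *
          OnlineForest.opt G c (OnlineForest.cumul f i) ∧
      OnlineForest.cost c σ'.F ≤
        8 * Real.logb 2 ((OnlineForest.terminals (OnlineForest.cumul f i)).card : ℝ) *
          OnlineForest.opt G c (OnlineForest.cumul f i) := by
  have hc' : ∀ e ∈ OnlineForest.edges G, 0 ≤ c e := fun e he =>
    hc e (by simpa [OnlineForest.edges] using he)
  obtain ⟨g₀, W, hW, hg₀⟩ := hσ.stateInv hc' hf
  have hg := OnlineForest.isProper_cumul hf i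
  have hE := OnlineForest.feasible_cumul hfeas i
  refine ⟨hW.exists_timeStep hc' hg hg₀ hE, fun σ' hσ' => ?_⟩
  obtain ⟨h1, h2, W', hW'⟩ := hW.timeStep hc' hg hg₀ hσ'
  exact ⟨h1, h2, hW'.competitive hc' hE⟩
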